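/- Let $K$ be a number field, and let $X$ be an integral scheme that is proper over $K$ (for example an integral projective variety). The set $\Sigma$ of places of $K$ consists of the maximal ideals $\mathfrak p$ of $\mathcal O_K$ and the embeddings $\sigma:K\to\mathbb C$. We put $|a|_{\mathfrak p}=p^{-v_{\mathfrak p}(a)}$, where $p$ is the characteristic of $\mathbb F_{\mathfrak p}=\mathcal O_K/\mathfrak p$, and $n_{\mathfrak p}=[\mathbb F_{\mathfrak p}:\mathbb F_p]$. For $v\in\Sigma$ let $X_v^{\mathrm{an}}$ be the Berkovich space of $X$ over $K_{\mathfrak p}$ if $v=\mathfrak p$, and the space $X_\sigma(\mathbb C)$ if $v=\sigma$. An *adelic line bundle* $\overline L=(L,(\|\cdot\|_v)_{v\in\Sigma})$ is an invertible $\mathcal O_X$-module $L$ with a continuous metric on $L$ over $X_v^{\mathrm{an}}$ for each $v$, such that the family of metrics at the infinite places is invariant under complex conjugation and almost all the metrics are induced by one model of $(X,L)$ over a non-empty open subscheme of $\operatorname{Spec}\mathcal O_K$. Their isometry classes form, under the tensor product, the group $\widehat{\mathrm{Pic}}(X)$. For $x\in X(\overline K)$ with field of definition $K(x)$, the height $h_{\overline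 L}(x)$ is the normalized Arakelov degree $$h_{\overline L}(x)=-\frac1{[K(x):\mathbb Q]}\Big(\sum_{w}n_w\log\|s\|_w+\sum_{\tau:K(x)\to\mathbb C}\log\|s\|_\tau\Big)$$ of $x^*\overline L$, where $w$ runs over the finite places of $K(x)$ and $s$ is any non-zero element of $x^*L$. Let $f$ be a continuous real function on $X_v^{\mathrm{an}}$, invariant under complex conjugation if $v$ is a real embedding. Then $\mathcal O_v(f)$ is the adelic line bundle with underlying module $\mathcal O_X$ and $\|\mathbf 1\|_{\mathfrak p}=(\#\mathbb F_{\mathfrak p})^{-f}$ if $v=\mathfrak p$ (resp. $\|\mathbf 1\|_\sigma=e^{-f}$, and the conjugate metric at $\overline\sigma$, if $v=\sigma$), and $\|\mathbf 1\|_w=1$ at all the other places $w$. Let $C_v(X)\subset\widehat{\mathrm{Pic}}(X)$ be the subgroup of the classes of the $\mathcal O_v(f)$. For $x\in X(\overline K)$ let $\eta_{x,v}$ be the probability measure on $X_v^{\mathrm{an}}$ which is the average of the Dirac measures at the $[K(x):K]$ points given by the $K$-embeddings of $K(x)$ in $\mathbb C_v$ (counted with multiplicity, where $\mathbb C_\sigma=\mathbb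 C$, viewed as an extension of $K$ via $\sigma$). A sequence $\underline x=(x_n)$ in $X(\overline K)$ *satisfies the equidistribution condition at $v$* if the measures $\eta_{x_n,v}$ converge weakly to a Borel probability measure on $X_v^{\mathrm{an}}$. For $\overline L\in\widehat{\mathrm{Pic}}(X)$ put $\varphi_{\underline x}(\overline L)=\liminf_{n\to\infty}h_{\overline L}(x_n)\in\mathbb R\cup\{\pm\infty\}$. **Proposition.** Let $v\in\Sigma$ and let $\underline x=(x_n)$ be a sequence in $X(\overline K)$. The following conditions are equivalent: 1. the sequence $\underline x$ satisfies the equidistribution condition at $v$; 2. the restriction of $\varphi_{\underline x}$ to $C_v(X)$ is additive, i.e. $\varphi_{\underline x}(\overline L\otimes\overline M)=\varphi_{\underline x}(\overline L)+\varphi_{\underline x}(\overline M)$ for all $\overline L,\overline M\in C_v(X)$. -/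

import Mathlib

open AlgebraicGeometry CategoryTheory TopologicalSpace MeasureTheory Filter NumberField
open IsDedekindDomain (HeightOneSpectrum)
open scoped NNReal ENNReal

universe u

set_option linter.unusedSectionVars false

noncomputable section

/-! ### Places of a number field and their absolute values -/

/-- The places of a number field as used here: the maximal ideals of its ring of integers and all
its complex embeddings (a complex place is counted twice, through its two embeddings). -/
inductive Place (K : Type u) [Field K] [NumberField K] : Type u
  | finite (p : HeightOneSpectrum (𝓞 K))
  | infinite (σ : K →+* ℂ)

namespace HeightOne

variable {K : Type u} [Field K] [NumberField K]

/-- The residue characteristic `p` of a maximal ideal. -/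
def resChar (p : HeightOneSpectrum (𝓞 K)) : ℕ := Ideal.absNorm (p.asIdeal.under ℤ)

/-- The degree `n_𝔭 = [𝔽_𝔭 : ℤ/p]` of the residue field. -/
def resDegree (p : HeightOneSpectrum (𝓞 K)) : ℕ := p.asIdeal.inertiaDeg ℤ

lemma resChar_prime (p : HeightOneSpectrum (𝓞 K)) : (resChar p).Prime :=
  have := p.isPrime
  have : NeZero p.asIdeal := ⟨p.ne_bot⟩
  Nat.absNorm_under_prime p.asIdeal

lemma one_lt_resChar (p : HeightOneSpectrum (𝓞 K)) : (1 : ℝ≥0) < resChar p := by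
  exact_mod_cast (resChar_prime p).one_lt

/-- The absolute value `|a|_𝔭 = p ^ (-v_𝔭(a))` on `K`. -/
def absV (p : HeightOneSpectrum (𝓞 K)) : AbsoluteValue K ℝ :=
  p.adicAbv (one_lt_resChar p)

section Extension

variable (K) {L : Type u} [Field L] [NumberField L] [Algebra K L]

/-- The ramification index `e(w|𝔭)`, where `𝔭 = w ∩ K`. -/
def ramIdx (w : HeightOneSpectrum (𝓞 L)) : ℕ := w.asIdeal.ramificationIdx (𝓞 K)

/-- The residue degree `f(w|𝔭)`, where `𝔭 = w ∩ K`. -/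
def resIdx (w : HeightOneSpectrum (𝓞 L)) : ℕ := w.asIdeal.inertiaDeg (𝓞 K)

lemma ramIdx_eq (w : HeightOneSpectrum (𝓞 L)) :
    (w.under (𝓞 K)).asIdeal.ramificationIdx' w.asIdeal = ramIdx K w :=
  have : w.asIdeal.LiesOver (w.under (𝓞 K)).asIdeal := ⟨rfl⟩
  have := w.isPrime
  Ideal.ramificationIdx'_eq_ramificationIdx _ _ (w.under (𝓞 K)).ne_bot

lemma ramIdx_ne_zero (w : HeightOneSpectrum (𝓞 L)) : ramIdx K w ≠ 0 := by
  have : w.asIdeal.LiesOver (w.under (𝓞 K)).asIdeal := ⟨rfl⟩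
  rw [← ramIdx_eq]
  exact Ideal.IsDedekindDomain.ramificationIdx'_ne_zero_of_liesOver w.asIdeal (w.under (𝓞 K)).ne_bot

lemma one_lt_extBase (w : HeightOneSpectrum (𝓞 L)) :
    (1 : ℝ≥0) < (resChar (w.under (𝓞 K)) : ℝ≥0) ^ ((ramIdx K w : ℝ)⁻¹) :=
  NNReal.one_lt_rpow (one_lt_resChar _)
    (by have := Nat.pos_of_ne_zero (ramIdx_ne_zero K w); positivity)

/-- The absolute value of `L` defined by `w` and normalised so that it extends `|.|_𝔭`,
`𝔭 = w ∩ K`: it is `b ↦ p ^ (-w(b) / e(w|𝔭))`. -/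
def extAbs (w : HeightOneSpectrum (𝓞 L)) : AbsoluteValue L ℝ :=
  w.adicAbv (one_lt_extBase K w)

lemma extAbs_algebraMap (w : HeightOneSpectrum (𝓞 L)) (a : K) :
    extAbs K w (algebraMap K L a) = absV (w.under (𝓞 K)) a := by
  have : w.asIdeal.LiesOver (w.under (𝓞 K)).asIdeal := ⟨rfl⟩
  have key := HeightOneSpectrum.valuation_liesOver (K := K) L (w.under (𝓞 K)) w a
  rw [ramIdx_eq] at key
  change ((WithZeroMulInt.toNNReal (ne_zero_of_lt (one_lt_extBase K w))
      (w.valuation L (algebraMap K L a)) : ℝ≥0) : ℝ) =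
    ((WithZeroMulInt.toNNReal (ne_zero_of_lt (one_lt_resChar (w.under (𝓞 K))))
      ((w.under (𝓞 K)).valuation K a) : ℝ≥0) : ℝ)
  rw [← key]
  norm_cast
  generalize (w.under (𝓞 K)).valuation K a = m
  by_cases hm : m = 0
  · subst hm
    simp [ramIdx_ne_zero K w]
  · rw [map_pow, WithZeroMulInt.toNNReal_neg_apply _ hm, WithZeroMulInt.toNNReal_neg_apply _ hm]
    have h0 : ((ramIdx K w : ℕ) : ℝ) ≠ 0 := by exact_mod_cast ramIdx_ne_zero K w
    rw [← zpow_natCast, ← zpow_mul, mul_comm, zpow_mul, zpow_natCast, ← NNReal.rpow_mul_natCast,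
      inv_mul_cancel₀ h0, NNReal.rpow_one]

end Extension

end HeightOne

/-! ### Analytic spaces attached to a variety over a number field -/

section Analytic

variable {K : Type u} [Field K] [NumberField K] {X : Scheme.{u}} (π : X ⟶ Spec (.of K))

/-- The structural homomorphism `K → κ(x)` of the residue field of a point of `X`. -/
def toResidue (x : X) : K →+* X.residueField x :=
  ((Scheme.ΓSpecIso (.of K)).inv ≫ π.appTop ≫ X.evaluation ⊤ x trivial).hom

/-- The Berkovich space `X_𝔭^an`. A point is a point `x` of `X` with an absolute value on `κ(x)`
extending `|.|_𝔭`. (On an affine open set these are the multiplicative seminorms on the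
coordinate ring `A` extending `|.|_𝔭` on `K`; by density of `K` in `K_𝔭` they are the same as the
multiplicative seminorms on `A ⊗ K_𝔭` extending that of `K_𝔭`, so this is the usual analytic space
over `K_𝔭`, which is also the quotient of the one over `ℂ_𝔭` by `Gal(ℂ_𝔭/K_𝔭)`.) -/
structure BerkovichPoint (p : HeightOneSpectrum (𝓞 K)) : Type u where
  pt : X
  abv : AbsoluteValue (X.residueField pt) ℝ
  abv_base : ∀ a : K, abv (toResidue π pt a) = HeightOne.absV p a

/-- The Berkovich topology: the coarsest one for which every `U^an` is open and every
`y ↦ |f(y)|`, `f ∈ Γ(X, U)`, is continuous on `U^an`. -/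
instance (p : HeightOneSpectrum (𝓞 K)) : TopologicalSpace (BerkovichPoint π p) :=
  .generateFrom {V | ∃ (U : X.Opens) (f : Γ(X, U)) (W : Set ℝ), IsOpen W ∧
    V = {y | ∃ h : y.pt ∈ U, y.abv (X.evaluation U y.pt h f) ∈ W}}

/-- The complex points `X_σ^an = X_σ(ℂ)`: a point `x` of `X` with an embedding `κ(x) → ℂ`
extending `σ`; this is the same as a morphism `Spec ℂ → X` over `σ`. -/
structure ComplexPoint (σ : K →+* ℂ) : Type u where
  pt : X
  emb : X.residueField pt →+* ℂ
  emb_base : emb.comp (toResidue π pt) = σ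

/-- The complex topology: the coarsest one for which every `U^an` is open and every
`y ↦ f(y)`, `f ∈ Γ(X, U)`, is continuous on `U^an`. -/
instance (σ : K →+* ℂ) : TopologicalSpace (ComplexPoint π σ) :=
  .generateFrom {V | ∃ (U : X.Opens) (f : Γ(X, U)) (W : Set ℂ), IsOpen W ∧
    V = {y | ∃ h : y.pt ∈ U, y.emb (X.evaluation U y.pt h f) ∈ W}}

/-- The analytic space `X_v^an`. -/
def An : Place K → Type u
  | .finite p => BerkovichPoint π p
  | .infinite σ => ComplexPoint π σ

instance : ∀ v : Place K, TopologicalSpace (An π v)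
  | .finite p => inferInstanceAs (TopologicalSpace (BerkovichPoint π p))
  | .infinite σ => inferInstanceAs (TopologicalSpace (ComplexPoint π σ))

/-- `X_v^an` carries its Borel σ-algebra. -/
instance (v : Place K) : MeasurableSpace (An π v) := borel _

instance (v : Place K) : BorelSpace (An π v) := ⟨rfl⟩

variable {π}

/-- The point of `X` below a point of `X_v^an`. -/
def An.pt : ∀ {v : Place K}, An π v → X
  | .finite _, y => BerkovichPoint.pt y
  | .infinite _, y => ComplexPoint.pt y

/-- The absolute value `a ↦ |a(y)|` on `κ(y)` defined by a point `y` of `X_v^an`. -/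
def An.abv : ∀ {v : Place K} (y : An π v), AbsoluteValue (X.residueField y.pt) ℝ
  | .finite _, y => BerkovichPoint.abv y
  | .infinite _, y => (NormedField.toAbsoluteValue ℂ).comp (ComplexPoint.emb y).injective

/-- `|f(y)|` for a regular function `f` near `y`. -/
def An.absEval {v : Place K} (y : An π v) (U : X.Opens) (h : y.pt ∈ U) (f : Γ(X, U)) : ℝ :=
  y.abv (X.evaluation U y.pt h f)

/-- Complex conjugation on places (finite places are fixed). -/
def Place.conj : Place K → Place K
  | .finite p => .finite p
  | .infinite σ => .infinite ((starRingEnd ℂ).comp σ)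

/-- The complex conjugate of a complex point. -/
def ComplexPoint.conj {σ : K →+* ℂ} (y : ComplexPoint π σ) :
    ComplexPoint π ((starRingEnd ℂ).comp σ) where
  pt := y.pt
  emb := (starRingEnd ℂ).comp y.emb
  emb_base := by rw [RingHom.comp_assoc, y.emb_base]

/-- Complex conjugation `X_σ^an → X_σ̄^an` (the identity at finite places). -/
def An.conj : ∀ {v : Place K}, An π v → An π v.conj
  | .finite _, y => y
  | .infinite _, y => ComplexPoint.conj y

@[simp] lemma An.pt_conj : ∀ {v : Place K} (y : An π v), y.conj.pt = y.pt
  | .finite _, _ => rfl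
  | .infinite _, _ => rfl

/-- Transport along an equality of places. -/
def An.cast {v w : Place K} (h : v = w) (y : An π v) : An π w := h ▸ y

/-! ### Invertible modules, metrics, adelic line bundles -/

/-- `s` is a basis of the `𝒪_X`-module `L` over the open set `U`. -/
def IsGenerator (L : X.Modules) (U : X.Opens) (s : Γ(L, U)) : Prop :=
  ∀ (V : X.Opens) (i : V ⟶ U),
    Function.Bijective fun a : Γ(X, V) => a • (L.presheaf.map i.op s : Γ(L, V))

/-- Invertible `𝒪_X`-modules: those that are locally free of rank one. -/
def IsInvertibleModule (L : X.Modules) : Prop :=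
  ∀ x : X, ∃ (U : X.Opens) (s : Γ(L, U)), x ∈ U ∧ IsGenerator L U s

variable (π)

/-- A continuous metric at the place `v` on an invertible `𝒪_X`-module `L`, given by the norms
`‖s‖_v(y)` of the sections of `L` over Zariski open sets (they determine those of all continuous
sections over analytic open sets, since `L` is locally generated by such sections). -/
structure LocalMetric (L : X.Modules) (v : Place K) where
  norm : ∀ (U : X.Opens) (_ : Γ(L, U)) (y : An π v), y.pt ∈ U → ℝ
  norm_nonneg : ∀ U s y h, 0 ≤ norm U s y h
  norm_res : ∀ {U V : X.Opens} (i : V ⟶ U) (s : Γ(L, U)) (y : An π v) (h : y.pt ∈ V),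
    norm V (L.presheaf.map i.op s) y h = norm U s y (i.le h)
  norm_smul : ∀ (U : X.Opens) (a : Γ(X, U)) (s : Γ(L, U)) (y : An π v) (h : y.pt ∈ U),
    norm U (a • s) y h = y.absEval U h a * norm U s y h
  norm_pos : ∀ (U : X.Opens) (s : Γ(L, U)) (y : An π v) (h : y.pt ∈ U),
    IsGenerator L U s → 0 < norm U s y h
  continuous_norm : ∀ (U : X.Opens) (s : Γ(L, U)),
    Continuous fun y : {y : An π v // y.pt ∈ U} => norm U s y.1 y.2

/-- Adelic line bundles `(L, (‖.‖_v)_v)` on `X`.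

The last field says that almost all the metrics come from one model of `(X, L)` over an open
subscheme of `Spec 𝓞_K`, expressed in charts of the model: near every point of `X` there are a basis
`s` of `L` over an open set `U` and finitely many functions `F` on `U` such that, for almost all
`𝔭`, `s` has norm one at all the points `y` at which the functions in `F` are integral, that is,
whose reduction lies in the chart. (One may shrink `U` and enlarge `F`, so that `U` is affine and `F`
generates its coordinate ring; then `𝓞_K[F]` is, over an open subscheme of `Spec 𝓞_K`, an affine
chart of any given model, and `s` is a basis of the extension of `L` to it.) -/
structure AdelicLineBundle where
  sheaf : X.Modules
  invertible : IsInvertibleModule sheaf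
  metric : ∀ v : Place K, LocalMetric π sheaf v
  conj_invariant : ∀ (v : Place K) (U : X.Opens) (s : Γ(sheaf, U)) (y : An π v) (h : y.pt ∈ U),
    (metric v.conj).norm U s y.conj (y.pt_conj ▸ h) = (metric v).norm U s y h
  model : ∀ x : X, ∃ (U : X.Opens) (s : Γ(sheaf, U)) (F : Finset Γ(X, U)),
    x ∈ U ∧ IsGenerator sheaf U s ∧ ∀ᶠ p : HeightOneSpectrum (𝓞 K) in cofinite,
      ∀ (y : An π (.finite p)) (h : y.pt ∈ U),
        (∀ a ∈ F, y.absEval U h a ≤ 1) → (metric (.finite p)).norm U s y h = 1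

variable {π}

namespace AdelicLineBundle

/-- The norm `‖s‖_v(y)`. -/
abbrev norm (L : AdelicLineBundle π) (v : Place K) (U : X.Opens) (s : Γ(L.sheaf, U)) (y : An π v)
    (h : y.pt ∈ U) : ℝ := (L.metric v).norm U s y h

/-- `L` and `M` define the same class in the arithmetic Picard group of `X`. -/
def Isometric (L M : AdelicLineBundle π) : Prop :=
  ∃ φ : L.sheaf ≅ M.sheaf, ∀ (v : Place K) (U : X.Opens) (s : Γ(L.sheaf, U)) (y : An π v)
    (h : y.pt ∈ U), M.norm v U (φ.hom.app U s) y h = L.norm v U s y h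

/-- `P` is a tensor product of `L` and `M`, i.e. its class is the sum of those of `L` and `M` in the
arithmetic Picard group: there is a bilinear pairing `(s, t) ↦ s ⊗ t` of `𝒪_X`-modules from `L × M`
to `P` that sends bases to bases and satisfies `‖s ⊗ t‖ = ‖s‖ ‖t‖`. -/
def IsTensorProduct (L M P : AdelicLineBundle π) : Prop :=
  ∃ μ : ∀ U : X.Opens, Γ(L.sheaf, U) →ₗ[Γ(X, U)] Γ(M.sheaf, U) →ₗ[Γ(X, U)] Γ(P.sheaf, U),
    (∀ (U V : X.Opens) (i : V ⟶ U) (s : Γ(L.sheaf, U)) (t : Γ(M.sheaf, U)),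
      P.sheaf.presheaf.map i.op (μ U s t) =
        μ V (L.sheaf.presheaf.map i.op s) (M.sheaf.presheaf.map i.op t)) ∧
    (∀ (U : X.Opens) (s : Γ(L.sheaf, U)) (t : Γ(M.sheaf, U)),
      IsGenerator L.sheaf U s → IsGenerator M.sheaf U t → IsGenerator P.sheaf U (μ U s t)) ∧
    ∀ (v : Place K) (U : X.Opens) (s : Γ(L.sheaf, U)) (t : Γ(M.sheaf, U)) (y : An π v)
      (h : y.pt ∈ U), P.norm v U (μ U s t) y h = L.norm v U s y h * M.norm v U t y h

end AdelicLineBundle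


/-! ### Metrics on the trivial bundle and the bundles `𝒪_v(f)` -/

/-- `𝒪_X` as an `𝒪_X`-module. -/
def structureModule (X : Scheme.{u}) : X.Modules := SheafOfModules.unit X.ringCatSheaf

/-- The sections of the `𝒪_X`-module `𝒪_X` are the regular functions. -/
def toFun {U : X.Opens} (s : Γ((structureModule X), U)) : Γ(X, U) := s

lemma toFun_smul {U : X.Opens} (a : Γ(X, U))
    (s : Γ((structureModule X), U)) :
    toFun (a • s) = a * toFun s := rfl

lemma toFun_map {U V : X.Opens} (i : V ⟶ U)
    (s : Γ((structureModule X), U)) :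
    toFun ((structureModule X).presheaf.map i.op s) =
      X.presheaf.map i.op (toFun s) := rfl

/-- The unit section `𝟏` of `𝒪_X`. -/
def unitSection (X : Scheme.{u}) (U : X.Opens) :
    Γ((structureModule X), U) := (1 : Γ(X, U))

lemma isGenerator_unitSection (U : X.Opens) :
    IsGenerator (structureModule X) U (unitSection X U) := by
  intro V i
  have : (fun a : Γ(X, V) => a • ((structureModule X).presheaf.map i.op
      (unitSection X U) : Γ((structureModule X), V))) =
      (fun a : Γ(X, V) => a) := by
    funext a
    change a * X.presheaf.map i.op (1 : Γ(X, U)) = a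
    rw [map_one, mul_one]
  rw [this]
  exact Function.bijective_id

lemma An.absEval_res {v : Place K} (y : An π v) {U V : X.Opens} (i : V ⟶ U) (h : y.pt ∈ V)
    (f : Γ(X, U)) : y.absEval V h (X.presheaf.map i.op f) = y.absEval U (i.le h) f := by
  have : X.evaluation V y.pt h (X.presheaf.map i.op f) = X.evaluation U y.pt (i.le h) f := by
    simp only [← Scheme.germ_residue]
    change X.residue y.pt (X.presheaf.germ V y.pt h (X.presheaf.map i.op f)) =
      X.residue y.pt (X.presheaf.germ U y.pt (i.le h) f)
    rw [TopCat.Presheaf.germ_res_apply]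
  exact congrArg y.abv this

lemma An.continuous_absEval {v : Place K} (U : X.Opens) (f : Γ(X, U)) :
    Continuous fun y : {y : An π v // y.pt ∈ U} => y.1.absEval U y.2 f := by
  refine continuous_def.2 fun W hW => ?_
  cases v with
  | finite p =>
    refine isOpen_induced_iff.2 ⟨{y : BerkovichPoint π p | ∃ h : y.pt ∈ U,
      y.abv (X.evaluation U y.pt h f) ∈ W}, .basic _ ⟨U, f, W, hW, rfl⟩, ?_⟩
    ext y
    exact ⟨fun ⟨_, h⟩ => h, fun h => ⟨y.2, h⟩⟩
  | infinite σ =>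
    refine isOpen_induced_iff.2 ⟨{y : ComplexPoint π σ | ∃ h : y.pt ∈ U,
      y.emb (X.evaluation U y.pt h f) ∈ (fun z : ℂ => ‖z‖) ⁻¹' W},
      .basic _ ⟨U, f, _, hW.preimage continuous_norm, rfl⟩, ?_⟩
    ext y
    exact ⟨fun ⟨_, h⟩ => h, fun h => ⟨y.2, h⟩⟩

lemma An.absEval_conj {v : Place K} (y : An π v) (U : X.Opens) (h : y.pt ∈ U) (f : Γ(X, U)) :
    y.conj.absEval U (y.pt_conj ▸ h) f = y.absEval U h f := by
  cases v with
  | finite p => rfl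
  | infinite σ => exact RCLike.norm_conj (K := ℂ) _

lemma An.conj_conj_cast {v : Place K} (y : An π v) (h : v.conj.conj = v) :
    y.conj.conj.cast h = y := by
  cases v with
  | finite p => rfl
  | infinite σ =>
    have aux : ∀ (τ : K →+* ℂ) (hτ : Place.infinite τ = Place.infinite σ) (z : ComplexPoint π τ)
        (y : ComplexPoint π σ), z.pt = y.pt → HEq z.emb y.emb →
          An.cast (π := π) (v := .infinite τ) hτ z = y := by
      intro τ hτ z y h1 h2
      obtain rfl := Place.infinite.inj hτ
      obtain ⟨zp, ze, hz⟩ := z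
      obtain ⟨yp, ye, hy⟩ := y
      obtain rfl : zp = yp := h1
      obtain rfl := eq_of_heq h2
      rfl
    exact aux _ h _ y rfl (heq_of_eq (RingHom.ext fun a => Complex.conj_conj _))

lemma Place.conj_conj (v : Place K) : v.conj.conj = v := by
  cases v with
  | finite p => rfl
  | infinite σ => exact congrArg Place.infinite (RingHom.ext fun a => Complex.conj_conj _)

lemma An.continuous_conj (v : Place K) : Continuous (An.conj : An π v → An π v.conj) := by
  cases v with
  | finite p => exact continuous_id
  | infinite σ =>
    refine continuous_generateFrom_iff.2 ?_
    rintro _ ⟨U, f, W, hW, rfl⟩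
    exact .basic _ ⟨U, f, _, hW.preimage Complex.continuous_conj, rfl⟩

/-- The metric on `𝒪_X` at `v` with `‖𝟏‖_v = exp (-g)`. -/
def weightMetric (v : Place K) (g : C(An π v, ℝ)) :
    LocalMetric π (structureModule X) v where
  norm U s y h := y.absEval U h (toFun s) * Real.exp (-g y)
  norm_nonneg U s y h := mul_nonneg (AbsoluteValue.nonneg _ _) (Real.exp_pos _).le
  norm_res i s y h := by rw [toFun_map, An.absEval_res]
  norm_smul U a s y h := by
    rw [toFun_smul, An.absEval, map_mul, map_mul, mul_assoc]
    rfl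
  norm_pos U s y h hs := by
    obtain ⟨a, ha⟩ := (hs U (𝟙 U)).2 (unitSection X U)
    have h1 : a * toFun s = 1 := by
      have h2 : a * X.presheaf.map (𝟙 U).op (toFun s) = 1 := ha
      rwa [op_id, X.presheaf.map_id] at h2
    refine mul_pos ((AbsoluteValue.pos_iff _).2 fun h0 => ?_) (Real.exp_pos _)
    have h3 := congrArg (X.evaluation U y.pt h) h1
    rw [map_mul, h0, mul_zero, map_one] at h3
    exact zero_ne_one h3
  continuous_norm U s := (An.continuous_absEval U _).mul
    (Real.continuous_exp.comp (g.continuous.comp continuous_subtype_val).neg)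

/-- The adelic line bundle with underlying module `𝒪_X` and `‖𝟏‖_v = exp (-g_v)` for all `v`. -/
def AdelicLineBundle.ofWeight (g : ∀ v : Place K, C(An π v, ℝ))
    (hconj : ∀ v (y : An π v), g v.conj y.conj = g v y)
    (hfin : ∀ᶠ p : HeightOneSpectrum (𝓞 K) in cofinite, ∀ y, g (.finite p) y = 0) :
    AdelicLineBundle π where
  sheaf := structureModule X
  invertible x := ⟨⊤, unitSection X ⊤, trivial, isGenerator_unitSection ⊤⟩
  metric v := weightMetric v (g v)
  conj_invariant v U s y h := by
    change y.conj.absEval U _ (toFun s) * Real.exp (-g v.conj y.conj) =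
      y.absEval U h (toFun s) * Real.exp (-g v y)
    rw [hconj, An.absEval_conj]
  model x := by
    refine ⟨⊤, unitSection X ⊤, ∅, trivial, isGenerator_unitSection ⊤, ?_⟩
    filter_upwards [hfin] with p hp y h _
    change An.abv y (X.evaluation ⊤ y.pt h (1 : Γ(X, ⊤))) * Real.exp (-g (.finite p) y) = 1
    rw [hp, map_one, map_one, neg_zero, Real.exp_zero, mul_one]

/-- The condition on a function `f` on `X_v^an` under which `𝒪_v(f)` has conjugation invariant
metrics: if `v` is a real embedding, `f` has to be invariant under the complex conjugation of
`X_v^an`. (It holds for all `f` if `v` is finite or not real.) -/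
def IsConjInvariant {v : Place K} (f : An π v → ℝ) : Prop :=
  ∀ (h : v.conj = v) (y : An π v), f (y.conj.cast h) = f y

/-- `log #𝔽_𝔭` for a finite place `𝔭`, and `1` for an infinite one. -/
def Place.logBase : Place K → ℝ
  | .finite p => Real.log (Ideal.absNorm p.asIdeal)
  | .infinite _ => 1

open Classical in
/-- The functions `-log ‖𝟏‖_w` of `𝒪_v(f)`: at `v` it is `f` (times `log #𝔽_v` if `v` is finite), at
the conjugate place it is the conjugate function, and at all other places it is zero. -/
def twistFun (v : Place K) (f : C(An π v, ℝ)) (w : Place K) (y : An π w) : ℝ :=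
  if h : w = v then v.logBase * f (y.cast h)
  else if h : w.conj = v then v.logBase * f (y.conj.cast h)
  else 0

lemma continuous_twistFun (v : Place K) (f : C(An π v, ℝ)) (w : Place K) :
    Continuous (twistFun v f w) := by
  by_cases h : w = v
  · subst h
    have : twistFun w f w = fun y => w.logBase * f y := by
      funext y
      rw [twistFun, dif_pos rfl]
      rfl
    rw [this]
    fun_prop
  by_cases h' : w.conj = v
  · subst h'
    have : twistFun w.conj f w = fun y => w.conj.logBase * f y.conj := by
      funext y
      rw [twistFun, dif_neg h, dif_pos rfl]
      rfl
    rw [this]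
    exact continuous_const.mul (f.continuous.comp (An.continuous_conj w))
  · have : twistFun v f w = fun _ => 0 := by
      funext y
      rw [twistFun, dif_neg h, dif_neg h']
    rw [this]
    exact continuous_const

lemma twistFun_conj (v : Place K) (f : C(An π v, ℝ)) (hf : IsConjInvariant f) (w : Place K)
    (y : An π w) : twistFun v f w.conj y.conj = twistFun v f w y := by
  by_cases h : w = v
  · subst h
    by_cases h' : w.conj = w
    · rw [twistFun, dif_pos h', hf h' y, twistFun, dif_pos rfl]
      rfl
    · rw [twistFun, dif_neg h', dif_pos w.conj_conj, An.conj_conj_cast, twistFun, dif_pos rfl]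
      rfl
  by_cases h' : w.conj = v
  · rw [twistFun, dif_pos h', twistFun, dif_neg h, dif_pos h']
  · have h'' : w.conj.conj ≠ v := by rwa [w.conj_conj]
    rw [twistFun, dif_neg h', dif_neg h'', twistFun, dif_neg h, dif_neg h']

/-- The adelic line bundle `𝒪_v(f)`. -/
def twist (v : Place K) (f : C(An π v, ℝ)) (hf : IsConjInvariant f) : AdelicLineBundle π :=
  .ofWeight (fun w => ⟨twistFun v f w, continuous_twistFun v f w⟩) (twistFun_conj v f hf) (by
    have hs : {p : HeightOneSpectrum (𝓞 K) | Place.finite p = v}.Finite :=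
      Set.Subsingleton.finite fun p hp q hq => Place.finite.inj (hp.trans hq.symm)
    filter_upwards [hs.compl_mem_cofinite] with p hp y
    change twistFun v f _ y = 0
    have hp' : ¬ Place.finite p = v := hp
    have hp'' : ¬ (Place.finite p).conj = v := hp
    rw [twistFun, dif_neg hp', dif_neg hp''])

variable (π) in
/-- The set `C_v(X)` of the adelic line bundles whose class in the arithmetic Picard group is that
of some `𝒪_v(f)`. -/
def metricTwists (v : Place K) : Set (AdelicLineBundle π) :=
  {L | ∃ (f : C(An π v, ℝ)) (hf : IsConjInvariant f), L.Isometric (twist v f hf)}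

/-! ### Algebraic points, their measures and their heights -/

variable (π) in
/-- Algebraic points of `X`: the elements of `X(K̄)`. -/
structure AlgPoint : Type u where
  hom : Spec (.of (AlgebraicClosure K)) ⟶ X
  hom_comp : hom ≫ π = Spec.map (CommRingCat.ofHom (algebraMap K (AlgebraicClosure K)))

namespace AlgPoint

/-- The closed point of the scheme `X` defined by an algebraic point. -/
def pt (P : AlgPoint π) : X := P.hom (IsLocalRing.closedPoint (AlgebraicClosure K))

/-- The field of definition `K(x)` of an algebraic point: the residue field of its image. -/
def DefField (P : AlgPoint π) : Type u := X.residueField P.pt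

instance (P : AlgPoint π) : Field P.DefField :=
  inferInstanceAs (Field (X.residueField P.pt))

instance (P : AlgPoint π) : Algebra K P.DefField := (toResidue π P.pt).toAlgebra

variable [IsProper π]

instance (P : AlgPoint π) : FiniteDimensional K P.DefField := by
  have h1 : IsIntegralHom (P.hom ≫ π) := by
    rw [P.hom_comp, IsIntegralHom.SpecMap_iff]
    exact Algebra.IsIntegral.isIntegral (R := K) (A := AlgebraicClosure K)
  have h2 : IsIntegralHom P.hom := .of_comp P.hom π
  have h3 : IsClosed {P.pt} := by
    have := P.hom.isClosedMap.isClosed_range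
    rwa [show Set.range P.hom = {P.pt} from Set.ext fun z => by
      constructor
      · rintro ⟨t, rfl⟩
        exact congrArg P.hom (Subsingleton.elim _ _)
      · rintro rfl
        exact ⟨_, rfl⟩] at this
  rw [isClosed_singleton_iff_isClosedImmersion] at h3
  have h4 : IsFinite (X.fromSpecResidueField P.pt ≫ π) := by
    rw [isFinite_iff_locallyOfFiniteType_of_jacobsonSpace]
    infer_instance
  have h5 : X.fromSpecResidueField P.pt ≫ π = Spec.map (CommRingCat.ofHom (toResidue π P.pt)) := by
    apply ext_to_Spec
    change _ ≫ (X.fromSpecResidueField P.pt ≫ π).appTop = _ ≫ (Spec.map _).appTop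
    rw [← Scheme.ΓSpecIso_inv_naturality, Scheme.Hom.comp_appTop, Scheme.fromSpecResidueField,
      Scheme.Hom.comp_appTop, Scheme.fromSpecStalk_appTop]
    have e1 : (Spec (X.presheaf.stalk P.pt)).presheaf.map (homOfLE le_top).op ≫
        (Spec.map (X.residue P.pt)).appTop = (Spec.map (X.residue P.pt)).appTop :=
      (congrArg (· ≫ (Spec.map (X.residue P.pt)).appTop)
        ((Spec (X.presheaf.stalk P.pt)).presheaf.map_id _)).trans (Category.id_comp _)
    have e2 : CommRingCat.ofHom (toResidue π P.pt) = (Scheme.ΓSpecIso (.of K)).inv ≫ π.appTop ≫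
        X.presheaf.germ ⊤ P.pt trivial ≫ X.residue P.pt := rfl
    rw [e2]
    simp only [Category.assoc]
    erw [e1]
    rw [← Scheme.ΓSpecIso_inv_naturality]
  rw [h5, IsFinite.SpecMap_iff] at h4
  exact h4

instance (P : AlgPoint π) : NumberField P.DefField where
  to_charZero := charZero_of_injective_algebraMap (algebraMap K P.DefField).injective
  to_finiteDimensional := by
    have : CharZero P.DefField :=
      charZero_of_injective_algebraMap (algebraMap K P.DefField).injective
    have : IsScalarTower ℚ K P.DefField := inferInstance
    exact Module.Finite.trans K P.DefField

/-- The point of `X_𝔭^an` (with `𝔭 = w ∩ K`) defined by an algebraic point `P` and a finite place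
`w` of `K(P)`. -/
def finitePoint (P : AlgPoint π) (w : HeightOneSpectrum (𝓞 P.DefField)) :
    An π (.finite (w.under (𝓞 K))) :=
  BerkovichPoint.mk P.pt (id (α := AbsoluteValue P.DefField ℝ) (HeightOne.extAbs K w))
    (HeightOne.extAbs_algebraMap K w)

/-- The point of `X_σ^an` (with `σ = τ|_K`) defined by an algebraic point `P` and an embedding `τ` of
`K(P)` in `ℂ`. -/
def complexPoint (P : AlgPoint π) (τ : P.DefField →+* ℂ) :
    An π (.infinite (τ.comp (algebraMap K P.DefField))) :=
  ComplexPoint.mk P.pt τ rfl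

/-- The probability measure `η_{P,v}` on `X_v^an`, the average of the Dirac measures at the
conjugates of `P`. For `v` infinite these correspond to the `[K(P) : K]` embeddings of `K(P)` in `ℂ`
extending `v`. For `v = 𝔭` finite, the `K`-embeddings of `K(P)` in `ℂ_𝔭` that define the same point
of `X_𝔭^an` are those that induce the same place `w ∣ 𝔭` of `K(P)`, and
there are `[K(P)_w : K_𝔭] = e(w|𝔭) f(w|𝔭)` of them. -/
def measure (P : AlgPoint π) : ∀ v : Place K, Measure (An π v)
  | .finite p => (Module.finrank K P.DefField : ℝ≥0∞)⁻¹ •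
      Measure.sum fun w : {w : HeightOneSpectrum (𝓞 P.DefField) // w.under (𝓞 K) = p} =>
        ((HeightOne.ramIdx K w.1 * HeightOne.resIdx K w.1 : ℕ) : ℝ≥0∞) •
          Measure.dirac ((P.finitePoint w.1).cast (congrArg Place.finite w.2))
  | .infinite σ => (Module.finrank K P.DefField : ℝ≥0∞)⁻¹ •
      Measure.sum fun τ : {τ : P.DefField →+* ℂ // τ.comp (algebraMap K P.DefField) = σ} =>
        Measure.dirac ((P.complexPoint τ.1).cast (congrArg Place.infinite τ.2))

end AlgPoint

namespace AdelicLineBundle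

variable [IsProper π]

/-- The normalised Arakelov degree
`-[K(P) : ℚ]⁻¹ (∑_{w finite} n_w log ‖s‖_w + ∑_{τ : K(P) → ℂ} log ‖s‖_τ)` of `P^*L`, computed with
the section `s` of `L` near `P`. For `w` above `𝔭` the norm `‖.‖_w` on `P^*L`, which is homogeneous
with respect to `|.|_w = p ^ (-w(.))`, is the power `e(w|𝔭)` of `‖.‖_𝔭` at the point defined by
`w`. -/
def degreeWith (L : AdelicLineBundle π) (P : AlgPoint π) (U : X.Opens) (hU : P.pt ∈ U)
    (s : Γ(L.sheaf, U)) : ℝ :=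
  -(Module.finrank ℚ P.DefField : ℝ)⁻¹ *
    ((∑ᶠ w : HeightOneSpectrum (𝓞 P.DefField), (HeightOne.resDegree w : ℝ) *
        Real.log (L.norm _ U s (P.finitePoint w) hU ^ HeightOne.ramIdx K w)) +
      ∑ τ : P.DefField →+* ℂ, Real.log (L.norm _ U s (P.complexPoint τ) hU))

/-- The height `h_L(P)`: the normalised Arakelov degree of `P^*L`, computed with any section of `L`
that is a basis near `P` (by the product formula, the choice does not matter). -/
def height (L : AdelicLineBundle π) (P : AlgPoint π) : ℝ :=
  L.degreeWith P (L.invertible P.pt).choose (L.invertible P.pt).choose_spec.choose_spec.1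
    (L.invertible P.pt).choose_spec.choose

end AdelicLineBundle

variable [IsProper π]

/-- The function `φ_x(L) = liminf h_L(x_n)`, with values in `ℝ ∪ {±∞}`. -/
def liminfHeight (x : ℕ → AlgPoint π) (L : AdelicLineBundle π) : EReal :=
  liminf (fun n => (L.height (x n) : EReal)) atTop

/-- The equidistribution condition at `v`: the measures `η_{x_n,v}` converge weakly to some Borel
probability measure on `X_v^an`. -/
def Equidistributed (v : Place K) (x : ℕ → AlgPoint π) : Prop :=
  ∃ μ : Measure (An π v), IsProbabilityMeasure μ ∧ ∀ f : C(An π v, ℝ),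
    Tendsto (fun n => ∫ y, f y ∂((x n).measure v)) atTop (nhds (∫ y, f y ∂μ))

/-- The restriction of `φ` to `C_v(X)` is additive: `φ(L ⊗ M) = φ(L) + φ(M)`. -/
def IsAdditiveOnTwists (v : Place K) (φ : AdelicLineBundle π → EReal) : Prop :=
  ∀ L ∈ metricTwists π v, ∀ M ∈ metricTwists π v, ∀ P : AdelicLineBundle π,
    L.IsTensorProduct M P → φ P = φ L + φ M

end Analytic
end

set_option linter.unusedSectionVars false

/-! The theorem rests on one formula: the height of `𝒪_v(f)` at an algebraic point `P` is `C * ∫ f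
dη_{P,v}`, with a constant `C > 0` depending only on `K` and `v`
(`AdelicLineBundle.exists_height_eq`). By the product formula the height depends only on the
functions `-log ‖𝟏‖_w`. At a finite place the local degrees `e(w|𝔭) f(w|𝔭)` in the height are the
weights of `η_{P,v}`; at an infinite place both sides sum over embeddings.

If the measures `η_{x_n,v}` converge, the heights of each twist converge, so `liminf` is a limit and
additivity is linearity of the integral. Conversely, additivity applied to `𝒪_v(f)` and `𝒪_v(-f)`,
whose product has height zero, gives `liminf u - limsup u = 0` for the heights `u` of `𝒪_v(f)`.
Hence `u` has a finite limit, and so have the integrals of `f`. At a real place this covers only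
conjugation invariant `f`; since `η_{P,v}` is conjugation invariant, the average of `f` and its
conjugate has the same integral as `f`, so all `f` are covered. The limit is a positive linear
functional with value `1` at the function `1`, and the Riesz representation theorem turns it into a
probability measure (`exists_limit_measure`).

Riesz needs `X_v^an` to be compact and Hausdorff. Given an ultrafilter on `X_v^an`, take the
ultraproduct of the residue fields of the points. Its elements of bounded absolute value form a
valuation ring, whose residue field carries the limit absolute value (or embeds in `ℂ`). The points
together define a point of `X` with values in the ultraproduct. The valuative criterion extends it
to the valuation ring, and the image of the closed point is the limit. Properness gives existence
(`exists_isUltraLimit`), separatedness gives uniqueness (`TendstoPoint.unique`). -/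

noncomputable section


/-! ### Ultraproducts of fields with absolute values -/

section UltraField

variable {ι : Type u} (k : ι → Type u) [∀ i, Field (k i)] (𝒰 : Ultrafilter ι)

/-- The ideal of the families that vanish almost everywhere. -/
def nullIdeal : Ideal (∀ i, k i) where
  carrier := {a | ∀ᶠ i in 𝒰, a i = 0}
  add_mem' ha hb := by
    filter_upwards [ha, hb] with i h1 h2
    rw [Pi.add_apply, h1, h2, add_zero]
  zero_mem' := Eventually.of_forall fun _ => rfl
  smul_mem' c a ha := by
    filter_upwards [ha] with i h
    rw [Pi.smul_apply', h, smul_zero]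

lemma mem_nullIdeal {a : ∀ i, k i} : a ∈ nullIdeal k 𝒰 ↔ ∀ᶠ i in 𝒰, a i = 0 := Iff.rfl

/-- As `𝒰` is an ultrafilter, a family outside the ideal is non-zero almost everywhere, so its
pointwise inverse is an inverse modulo the ideal. -/
instance : (nullIdeal k 𝒰).IsMaximal := by
  classical
  refine Ideal.isMaximal_iff.2 ⟨fun h => ?_, fun J a hJ ha haJ => ?_⟩
  · obtain ⟨i, hi⟩ := ((mem_nullIdeal k 𝒰).1 h).exists
    exact one_ne_zero hi
  · have h1 : (1 : ∀ i, k i) - a⁻¹ * a ∈ nullIdeal k 𝒰 := by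
      have h2 : ∀ᶠ i in 𝒰, a i ≠ 0 := Ultrafilter.eventually_not.2 ha
      filter_upwards [h2] with i hi
      rw [Pi.sub_apply, Pi.one_apply, Pi.mul_apply, Pi.inv_apply, inv_mul_cancel₀ hi, sub_self]
    have h3 := J.add_mem (hJ h1) (J.mul_mem_left a⁻¹ haJ)
    rwa [sub_add_cancel] at h3

/-- The ultraproduct of a family of fields. -/
def UltraField : Type u := (∀ i, k i) ⧸ nullIdeal k 𝒰

instance : Field (UltraField k 𝒰) := Ideal.Quotient.field (nullIdeal k 𝒰)

namespace UltraField

/-- The class of a family in the ultraproduct. -/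
def mk : (∀ i, k i) →+* UltraField k 𝒰 := Ideal.Quotient.mk (nullIdeal k 𝒰)

lemma mk_surjective : Function.Surjective (mk k 𝒰) := Ideal.Quotient.mk_surjective

variable {k 𝒰}

lemma mk_eq_zero {a : ∀ i, k i} : mk k 𝒰 a = 0 ↔ ∀ᶠ i in 𝒰, a i = 0 :=
  Ideal.Quotient.eq_zero_iff_mem

lemma mk_eq_mk {a b : ∀ i, k i} : mk k 𝒰 a = mk k 𝒰 b ↔ ∀ᶠ i in 𝒰, a i = b i := by
  rw [← sub_eq_zero, ← map_sub, mk_eq_zero]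
  simp only [Pi.sub_apply, sub_eq_zero]

lemma mk_inv (a : ∀ i, k i) : mk k 𝒰 a⁻¹ = (mk k 𝒰 a)⁻¹ := by
  by_cases h : ∀ᶠ i in 𝒰, a i = 0
  · rw [mk_eq_zero.2 h, inv_zero, mk_eq_zero]
    filter_upwards [h] with i hi
    rw [Pi.inv_apply, hi, inv_zero]
  · refine eq_inv_of_mul_eq_one_left ?_
    rw [← map_mul, ← map_one (mk k 𝒰), mk_eq_mk]
    filter_upwards [Ultrafilter.eventually_not.2 h] with i hi
    exact inv_mul_cancel₀ hi

variable (abv : ∀ i, AbsoluteValue (k i) ℝ)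

variable (𝒰) in
/-- The valuation ring of the ultraproduct that consists of the bounded elements. -/
def bounded : ValuationSubring (UltraField k 𝒰) where
  carrier := {z | ∃ a, mk k 𝒰 a = z ∧ ∃ M : ℝ, ∀ᶠ i in 𝒰, abv i (a i) ≤ M}
  mul_mem' := by
    rintro _ _ ⟨a, rfl, M, hM⟩ ⟨b, rfl, N, hN⟩
    refine ⟨a * b, map_mul _ _ _, M * N, ?_⟩
    filter_upwards [hM, hN] with i h1 h2
    rw [Pi.mul_apply, map_mul]
    exact mul_le_mul h1 h2 ((abv i).nonneg _) (((abv i).nonneg _).trans h1)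
  one_mem' := ⟨1, map_one _, 1, Eventually.of_forall fun i => by rw [Pi.one_apply, map_one]⟩
  add_mem' := by
    rintro _ _ ⟨a, rfl, M, hM⟩ ⟨b, rfl, N, hN⟩
    refine ⟨a + b, map_add _ _ _, M + N, ?_⟩
    filter_upwards [hM, hN] with i h1 h2
    exact ((abv i).add_le _ _).trans (add_le_add h1 h2)
  zero_mem' := ⟨0, map_zero _, 0, Eventually.of_forall fun i => by rw [Pi.zero_apply, map_zero]⟩
  neg_mem' := by
    rintro _ ⟨a, rfl, M, hM⟩
    refine ⟨-a, map_neg _ _, M, ?_⟩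
    filter_upwards [hM] with i h1
    rwa [Pi.neg_apply, (abv i).map_neg]
  mem_or_inv_mem' := by
    intro z
    obtain ⟨a, rfl⟩ := mk_surjective k 𝒰 z
    -- An ultrafilter decides between `|a| ≤ 1` and `|a| > 1`. No ultrametric inequality is
    -- involved, so archimedean and non-archimedean places are treated alike.
    rcases 𝒰.em fun i => abv i (a i) ≤ 1 with h | h
    · exact .inl ⟨a, rfl, 1, h⟩
    · refine .inr ⟨a⁻¹, mk_inv a, 1, ?_⟩
      filter_upwards [h] with i hi
      rw [Pi.inv_apply, map_inv₀]
      exact inv_le_one_of_one_le₀ (not_le.1 hi).le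

lemma mk_mem_bounded {a : ∀ i, k i} :
    mk k 𝒰 a ∈ bounded 𝒰 abv ↔ ∃ M : ℝ, ∀ᶠ i in 𝒰, abv i (a i) ≤ M := by
  refine ⟨?_, fun h => ⟨a, rfl, h⟩⟩
  rintro ⟨b, hb, M, hM⟩
  refine ⟨M, ?_⟩
  filter_upwards [mk_eq_mk.1 hb, hM] with i h1 h2
  rwa [← h1]

variable {abv}

/-- The image ultrafilter lives on a closed ball, which is compact. -/
lemma exists_tendsto_of_bounded {E : Type*} [NormedAddCommGroup E] [ProperSpace E] {f : ι → E}
    {M : ℝ} (h : ∀ᶠ i in 𝒰, ‖f i‖ ≤ M) : ∃ r, Tendsto f 𝒰 (nhds r) := by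
  have hc := isCompact_iff_ultrafilter_le_nhds.1 (isCompact_closedBall (0 : E) M) (𝒰.map f) (by
    rw [le_principal_iff, Ultrafilter.coe_map, mem_map]
    filter_upwards [h] with i hi
    simpa using hi)
  obtain ⟨r, -, hr⟩ := hc
  exact ⟨r, hr⟩

/-- The limit of the absolute values of a bounded family. -/
def stdAbs (z : bounded 𝒰 abv) : ℝ :=
  lim ((𝒰 : Filter ι).map fun i => abv i ((mk_surjective k 𝒰 z.1).choose i))

lemma tendsto_stdAbs {a : ∀ i, k i} (h : mk k 𝒰 a ∈ bounded 𝒰 abv) :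
    Tendsto (fun i => abv i (a i)) 𝒰 (nhds (stdAbs ⟨mk k 𝒰 a, h⟩)) := by
  have h1 := (mk_surjective k 𝒰 (mk k 𝒰 a)).choose_spec
  have h2 := (mk_mem_bounded abv).1 (h1.symm ▸ h)
  obtain ⟨M, hM⟩ := h2
  have h3 := exists_tendsto_of_bounded (𝒰 := 𝒰)
    (f := fun i => abv i ((mk_surjective k 𝒰 (mk k 𝒰 a)).choose i)) (M := M) (by
      filter_upwards [hM] with i hi
      rwa [Real.norm_of_nonneg ((abv i).nonneg _)])
  refine Tendsto.congr' ?_ (le_nhds_lim h3)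
  filter_upwards [mk_eq_mk.1 h1] with i hi
  rw [hi]

lemma stdAbs_eq {a : ∀ i, k i} (h : mk k 𝒰 a ∈ bounded 𝒰 abv) {r : ℝ}
    (hr : Tendsto (fun i => abv i (a i)) 𝒰 (nhds r)) : stdAbs ⟨mk k 𝒰 a, h⟩ = r :=
  tendsto_nhds_unique (tendsto_stdAbs h) hr

lemma stdAbs_nonneg (z : bounded 𝒰 abv) : 0 ≤ stdAbs z := by
  obtain ⟨z, hz⟩ := z
  obtain ⟨a, rfl⟩ := mk_surjective k 𝒰 z
  exact ge_of_tendsto (tendsto_stdAbs hz) (Eventually.of_forall fun i => (abv i).nonneg _)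

lemma stdAbs_mul (z w : bounded 𝒰 abv) : stdAbs (z * w) = stdAbs z * stdAbs w := by
  obtain ⟨z, hz⟩ := z
  obtain ⟨w, hw⟩ := w
  obtain ⟨a, rfl⟩ := mk_surjective k 𝒰 z
  obtain ⟨b, rfl⟩ := mk_surjective k 𝒰 w
  have h : mk k 𝒰 (a * b) ∈ bounded 𝒰 abv := by rw [map_mul]; exact mul_mem hz hw
  have e : (⟨mk k 𝒰 a, hz⟩ * ⟨mk k 𝒰 b, hw⟩ : bounded 𝒰 abv) = ⟨mk k 𝒰 (a * b), h⟩ :=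
    Subtype.ext (map_mul (mk k 𝒰) a b).symm
  rw [e]
  refine stdAbs_eq h (Tendsto.congr (fun i => ?_) ((tendsto_stdAbs hz).mul (tendsto_stdAbs hw)))
  rw [Pi.mul_apply, map_mul]

lemma stdAbs_add_le (z w : bounded 𝒰 abv) : stdAbs (z + w) ≤ stdAbs z + stdAbs w := by
  obtain ⟨z, hz⟩ := z
  obtain ⟨w, hw⟩ := w
  obtain ⟨a, rfl⟩ := mk_surjective k 𝒰 z
  obtain ⟨b, rfl⟩ := mk_surjective k 𝒰 w
  have h : mk k 𝒰 (a + b) ∈ bounded 𝒰 abv := by rw [map_add]; exact add_mem hz hw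
  have e : (⟨mk k 𝒰 a, hz⟩ + ⟨mk k 𝒰 b, hw⟩ : bounded 𝒰 abv) = ⟨mk k 𝒰 (a + b), h⟩ :=
    Subtype.ext (map_add (mk k 𝒰) a b).symm
  rw [e]
  exact le_of_tendsto_of_tendsto (tendsto_stdAbs h)
    ((tendsto_stdAbs hz).add (tendsto_stdAbs hw)) (Eventually.of_forall fun i => (abv i).add_le _ _)

lemma stdAbs_one : stdAbs (1 : bounded 𝒰 abv) = 1 := by
  have e : (1 : bounded 𝒰 abv) = ⟨mk k 𝒰 1, by rw [map_one]; exact one_mem _⟩ :=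
    Subtype.ext (map_one (mk k 𝒰)).symm
  rw [e]
  refine stdAbs_eq _ (Tendsto.congr (fun i => ?_) tendsto_const_nhds)
  rw [Pi.one_apply, map_one]

/-- If the limit is `r > 0`, the absolute values exceed `r / 2` almost everywhere, so the pointwise
inverse is bounded. Thus the maximal ideal consists of the infinitesimals, and `stdAbs` descends to
an absolute value on the residue field. -/
lemma isUnit_iff_stdAbs_ne_zero (z : bounded 𝒰 abv) : IsUnit z ↔ stdAbs z ≠ 0 := by
  constructor
  · rintro h h0
    obtain ⟨w, hw⟩ := h.exists_right_inv
    have := stdAbs_mul z w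
    rw [hw, h0, zero_mul, stdAbs_one] at this
    exact one_ne_zero this
  · intro h
    obtain ⟨z, hz⟩ := z
    obtain ⟨a, rfl⟩ := mk_surjective k 𝒰 z
    have hpos := (stdAbs_nonneg _).lt_of_ne' h
    set r := stdAbs ⟨mk k 𝒰 a, hz⟩
    have h1 : ∀ᶠ i in 𝒰, r / 2 < abv i (a i) :=
      (tendsto_stdAbs hz).eventually_const_lt (half_lt_self hpos)
    have h2 : mk k 𝒰 a⁻¹ ∈ bounded 𝒰 abv := by
      refine (mk_mem_bounded abv).2 ⟨(r / 2)⁻¹, ?_⟩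
      filter_upwards [h1] with i hi
      rw [Pi.inv_apply, map_inv₀]
      exact inv_anti₀ (half_pos hpos) hi.le
    refine IsUnit.of_mul_eq_one ⟨_, h2⟩ (Subtype.ext ?_)
    change mk k 𝒰 a * mk k 𝒰 a⁻¹ = 1
    rw [← map_mul, ← map_one (mk k 𝒰), mk_eq_mk]
    filter_upwards [h1] with i hi
    exact mul_inv_cancel₀ fun h0 => by
      rw [h0, map_zero] at hi
      exact (half_pos hpos).not_gt hi

lemma stdAbs_eq_zero_iff (z : bounded 𝒰 abv) :
    stdAbs z = 0 ↔ z ∈ IsLocalRing.maximalIdeal (bounded 𝒰 abv) := by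
  rw [IsLocalRing.mem_maximalIdeal, mem_nonunits_iff, isUnit_iff_stdAbs_ne_zero, not_not]

lemma stdAbs_congr {z w : bounded 𝒰 abv}
    (h : IsLocalRing.residue _ z = IsLocalRing.residue _ w) : stdAbs z = stdAbs w := by
  have key : ∀ z w : bounded 𝒰 abv, IsLocalRing.residue _ z = IsLocalRing.residue _ w →
      stdAbs z ≤ stdAbs w := by
    intro z w h
    have h1 : stdAbs (z - w) = 0 := by
      rw [stdAbs_eq_zero_iff, ← IsLocalRing.residue_eq_zero_iff, map_sub, h, sub_self]
    have h2 := stdAbs_add_le (z - w) w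
    rwa [sub_add_cancel, h1, zero_add] at h2
  exact (key z w h).antisymm (key w z h.symm)

variable (𝒰 abv) in
/-- The absolute value on the residue field of the ring of bounded elements. -/
def residueAbs : AbsoluteValue (IsLocalRing.ResidueField (bounded 𝒰 abv)) ℝ where
  toFun q := stdAbs (Function.surjInv IsLocalRing.residue_surjective q)
  map_mul' x y := by
    rw [← stdAbs_mul]
    refine stdAbs_congr ?_
    simp only [map_mul, Function.surjInv_eq]
  nonneg' _ := stdAbs_nonneg _
  eq_zero' x := by
    rw [stdAbs_eq_zero_iff, ← IsLocalRing.residue_eq_zero_iff,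
      Function.surjInv_eq IsLocalRing.residue_surjective]
  add_le' x y := by
    refine le_trans (le_of_eq (stdAbs_congr ?_)) (stdAbs_add_le _ _)
    simp only [map_add, Function.surjInv_eq]

lemma residueAbs_residue (z : bounded 𝒰 abv) :
    residueAbs 𝒰 abv (IsLocalRing.residue _ z) = stdAbs z :=
  stdAbs_congr (Function.surjInv_eq _ _)

/-! If the fields are subfields of `ℂ`, so is the residue field of the ring of bounded elements. -/

variable (e : ∀ i, k i →+* ℂ)

/-- The absolute value induced by an embedding in `ℂ`. -/
abbrev complexAbs (i : ι) : AbsoluteValue (k i) ℝ :=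
  (NormedField.toAbsoluteValue ℂ).comp (e i).injective

/-- The limit in `ℂ` of a bounded family. -/
def stdFun (z : bounded 𝒰 (complexAbs e)) : ℂ :=
  lim ((𝒰 : Filter ι).map fun i => e i ((mk_surjective k 𝒰 z.1).choose i))

variable {e}

lemma tendsto_stdFun {a : ∀ i, k i} (h : mk k 𝒰 a ∈ bounded 𝒰 (complexAbs e)) :
    Tendsto (fun i => e i (a i)) 𝒰 (nhds (stdFun e ⟨mk k 𝒰 a, h⟩)) := by
  have h1 := (mk_surjective k 𝒰 (mk k 𝒰 a)).choose_spec
  obtain ⟨M, hM⟩ := (mk_mem_bounded _).1 (h1.symm ▸ h)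
  have h3 := exists_tendsto_of_bounded (𝒰 := 𝒰)
    (f := fun i => e i ((mk_surjective k 𝒰 (mk k 𝒰 a)).choose i)) (M := M) hM
  refine Tendsto.congr' ?_ (le_nhds_lim h3)
  filter_upwards [mk_eq_mk.1 h1] with i hi
  rw [hi]

lemma stdFun_eq {a : ∀ i, k i} {z : bounded 𝒰 (complexAbs e)} (hz : mk k 𝒰 a = z.1) {r : ℂ}
    (hr : Tendsto (fun i => e i (a i)) 𝒰 (nhds r)) : stdFun e z = r := by
  obtain ⟨z, h⟩ := z
  obtain rfl : mk k 𝒰 a = z := hz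
  exact tendsto_nhds_unique (tendsto_stdFun h) hr

variable (𝒰 e) in
/-- The limit of bounded families, as a ring homomorphism. -/
def stdHom : bounded 𝒰 (complexAbs e) →+* ℂ where
  toFun := stdFun e
  map_one' := stdFun_eq (a := 1) (map_one _)
    (tendsto_const_nhds.congr fun i => by rw [Pi.one_apply, map_one])
  map_zero' := stdFun_eq (a := 0) (map_zero _)
    (tendsto_const_nhds.congr fun i => by rw [Pi.zero_apply, map_zero])
  map_mul' := by
    rintro ⟨z, hz⟩ ⟨w, hw⟩
    obtain ⟨a, rfl⟩ := mk_surjective k 𝒰 z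
    obtain ⟨b, rfl⟩ := mk_surjective k 𝒰 w
    exact stdFun_eq (a := a * b) (map_mul _ _ _)
      (((tendsto_stdFun hz).mul (tendsto_stdFun hw)).congr fun i => (map_mul _ _ _).symm)
  map_add' := by
    rintro ⟨z, hz⟩ ⟨w, hw⟩
    obtain ⟨a, rfl⟩ := mk_surjective k 𝒰 z
    obtain ⟨b, rfl⟩ := mk_surjective k 𝒰 w
    exact stdFun_eq (a := a + b) (map_add _ _ _)
      (((tendsto_stdFun hz).add (tendsto_stdFun hw)).congr fun i => (map_add _ _ _).symm)

lemma norm_stdHom (z : bounded 𝒰 (complexAbs e)) : ‖stdHom 𝒰 e z‖ = stdAbs z := by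
  obtain ⟨z, hz⟩ := z
  obtain ⟨a, rfl⟩ := mk_surjective k 𝒰 z
  exact (stdAbs_eq hz (tendsto_stdFun hz).norm).symm

/-- This is what lets `stdHom` factor through the residue field. -/
instance : IsLocalHom (stdHom 𝒰 e) where
  map_nonunit z hz := by
    rw [isUnit_iff_stdAbs_ne_zero, ← norm_stdHom, norm_ne_zero_iff]
    exact hz.ne_zero

variable (𝒰 e) in
/-- The embedding in `ℂ` of the residue field of the ring of bounded elements. -/
def residueHom : IsLocalRing.ResidueField (bounded 𝒰 (complexAbs e)) →+* ℂ :=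
  IsLocalRing.ResidueField.lift (stdHom 𝒰 e)

lemma residueHom_residue (z : bounded 𝒰 (complexAbs e)) :
    residueHom 𝒰 e (IsLocalRing.residue _ z) = stdHom 𝒰 e z :=
  IsLocalRing.ResidueField.lift_residue_apply _ z

end UltraField

end UltraField


/-! ### Morphisms from spectra of local rings to a scheme -/

section LocalRing

variable {X : Scheme.{u}} {R : Type u} [CommRing R] [IsLocalRing R]

/-- The morphism `Spec R ⟶ V ⟶ X` defined by a ring homomorphism `Γ(X, V) ⟶ R`. -/
def specTo {V : X.Opens} (hV : IsAffineOpen V) (φ : Γ(X, V) →+* R) : Spec (.of R) ⟶ X :=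
  Spec.map (CommRingCat.ofHom φ) ≫ hV.fromSpec

/-- The closed point maps to the prime `φ⁻¹(𝔪)`, and the elements outside `𝔪` are the units. -/
lemma specTo_closedPoint_mem_basicOpen {V : X.Opens} (hV : IsAffineOpen V) (φ : Γ(X, V) →+* R)
    (f : Γ(X, V)) : specTo hV φ (IsLocalRing.closedPoint R) ∈ X.basicOpen f ↔ IsUnit (φ f) := by
  have h : Spec.map (CommRingCat.ofHom φ) (IsLocalRing.closedPoint R) ∈
      hV.fromSpec ⁻¹ᵁ X.basicOpen f ↔ IsUnit (φ f) := by
    rw [hV.fromSpec_preimage_basicOpen]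
    change ¬ φ f ∈ IsLocalRing.maximalIdeal R ↔ _
    rw [IsLocalRing.mem_maximalIdeal, mem_nonunits_iff, not_not]
  exact h

lemma specTo_closedPoint_mem {V : X.Opens} (hV : IsAffineOpen V) (φ : Γ(X, V) →+* R) :
    specTo hV φ (IsLocalRing.closedPoint R) ∈ V :=
  X.basicOpen_le (1 : Γ(X, V))
    ((specTo_closedPoint_mem_basicOpen hV φ 1).2 (by rw [map_one]; exact isUnit_one))

lemma specTo_injective {V : X.Opens} (hV : IsAffineOpen V) {φ ψ : Γ(X, V) →+* R}
    (h : specTo hV φ = specTo hV ψ) : φ = ψ := by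
  have h1 := Spec.map_injective ((cancel_mono hV.fromSpec).1 h)
  exact congrArg CommRingCat.Hom.hom h1

lemma specTo_of_le {V W : X.Opens} (hV : IsAffineOpen V) (hW : IsAffineOpen W) (i : W ⟶ V)
    (φ : Γ(X, W) →+* R) : specTo hV (φ.comp (X.presheaf.map i.op).hom) = specTo hW φ := by
  rw [specTo, specTo, CommRingCat.ofHom_comp, Spec.map_comp, Category.assoc]
  exact congrArg _ (hV.map_fromSpec hW i.op)

/-- The ring homomorphism `Γ(X, V) ⟶ R` defined by a morphism `Spec R ⟶ X` which maps the closed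
point into `V`. -/
def localEval (l : Spec (.of R) ⟶ X) (V : X.Opens) (h : l (IsLocalRing.closedPoint R) ∈ V) :
    Γ(X, V) →+* R :=
  (X.presheaf.germ V _ h ≫ Scheme.stalkClosedPointTo l).hom

/-- A morphism from the spectrum of a local ring factors through the stalk at the image of the
closed point. Together with `specTo_injective` it reduces such morphisms to ring homomorphisms. -/
lemma specTo_localEval (l : Spec (.of R) ⟶ X) {V : X.Opens} (hV : IsAffineOpen V)
    (h : l (IsLocalRing.closedPoint R) ∈ V) : specTo hV (localEval l V h) = l := by
  conv_rhs => rw [← Scheme.Spec_stalkClosedPointTo_fromSpecStalk l]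
  rw [← hV.fromSpecStalk_eq_fromSpecStalk h, IsAffineOpen.fromSpecStalk, ← Spec.map_comp_assoc]
  rfl

/-- The embedding of the residue field of the image of the closed point in that of `R`. -/
def localResidue (l : Spec (.of R) ⟶ X) :
    X.residueField (l (IsLocalRing.closedPoint R)) →+* IsLocalRing.ResidueField R :=
  IsLocalRing.ResidueField.map (Scheme.stalkClosedPointTo l).hom

lemma specTo_comp_map {S : Type u} [CommRing S] [IsLocalRing S] {V : X.Opens}
    (hV : IsAffineOpen V) (φ : Γ(X, V) →+* R) (θ : R →+* S) :
    Spec.map (CommRingCat.ofHom θ) ≫ specTo hV φ = specTo hV (θ.comp φ) := by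
  rw [specTo, specTo, CommRingCat.ofHom_comp, Spec.map_comp, Category.assoc]

lemma specTo_comp {K : Type u} [CommRing K] (π : X ⟶ Spec (.of K)) {V : X.Opens}
    (hV : IsAffineOpen V) (φ : Γ(X, V) →+* R) :
    specTo hV φ ≫ π = Spec.map ((Scheme.ΓSpecIso (.of K)).inv ≫ π.appTop ≫
      X.presheaf.map (homOfLE le_top).op ≫ CommRingCat.ofHom φ) := by
  have h := IsAffineOpen.SpecMap_appLE_fromSpec π (isAffineOpen_top _) hV le_top
  rw [IsAffineOpen.fromSpec_top, Scheme.isoSpec_Spec_inv] at h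
  rw [specTo, Category.assoc, ← h, ← Spec.map_comp_assoc, ← Spec.map_comp]
  rfl

/-- Basic open sets form a basis of the affine `V`, and schemes are `T₀`. -/
lemma eq_of_mem_basicOpen_iff {V : X.Opens} (hV : IsAffineOpen V) {x y : X} (hx : x ∈ V)
    (hy : y ∈ V) (h : ∀ f : Γ(X, V), x ∈ X.basicOpen f ↔ y ∈ X.basicOpen f) : x = y := by
  refine Inseparable.eq (inseparable_iff_forall_isOpen.2 fun s hs => ?_)
  constructor
  · intro hxs
    obtain ⟨f, hf, hxf⟩ := hV.exists_basicOpen_le (V := ⟨s, hs⟩) ⟨x, hxs⟩ hx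
    exact hf ((h f).1 hxf)
  · intro hys
    obtain ⟨f, hf, hyf⟩ := hV.exists_basicOpen_le (V := ⟨s, hs⟩) ⟨y, hys⟩ hy
    exact hf ((h f).2 hyf)

lemma exists_evaluation_eq {x : X} (a : X.residueField x) :
    ∃ (U : X.Opens) (h : x ∈ U) (f : Γ(X, U)), X.evaluation U x h f = a := by
  obtain ⟨s, rfl⟩ := X.residue_surjective x a
  obtain ⟨U, h, f, rfl⟩ := X.presheaf.exists_germ_eq s
  exact ⟨U, h, f, rfl⟩

end LocalRing


/-! ### Morphisms from spectra of local rings to a scheme -/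

/-! ### Analytic spaces are compact and separated -/

/-! ### Limits of families of points along an ultrafilter -/

section Limit

variable {K : Type u} [Field K] [NumberField K] {X : Scheme.{u}} (π : X ⟶ Spec (.of K))
  {ι : Type u} (pt : ι → X) (𝒰 : Ultrafilter ι)

/-- The ultraproduct of the residue fields of a family of points. -/
abbrev ultraResidue : Type u := UltraField (fun i => X.residueField (pt i)) 𝒰

open Classical in
/-- The values of a function on a family of points (zero where it is not defined). -/
def familyEval (U : X.Opens) (f : Γ(X, U)) (i : ι) : X.residueField (pt i) :=
  if h : pt i ∈ U then X.evaluation U (pt i) h f else 0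

variable {pt}

lemma familyEval_of_mem {U : X.Opens} (f : Γ(X, U)) {i : ι} (h : pt i ∈ U) :
    familyEval pt U f i = X.evaluation U (pt i) h f := dif_pos h

lemma evaluation_map {U V : X.Opens} (i : V ⟶ U) {x : X} (h : x ∈ V) (f : Γ(X, U)) :
    X.evaluation V x h (X.presheaf.map i.op f) = X.evaluation U x (i.le h) f := by
  simp only [← Scheme.germ_residue]
  change X.residue x (X.presheaf.germ V x h (X.presheaf.map i.op f)) =
    X.residue x (X.presheaf.germ U x (i.le h) f)
  rw [TopCat.Presheaf.germ_res_apply]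

variable {𝒰}

/-- The evaluation of functions at almost all points of a family. -/
def ultraEval (U : X.Opens) (hU : ∀ᶠ i in 𝒰, pt i ∈ U) : Γ(X, U) →+* ultraResidue pt 𝒰 where
  toFun f := UltraField.mk _ 𝒰 (familyEval pt U f)
  map_one' := by
    rw [← map_one (UltraField.mk _ 𝒰), UltraField.mk_eq_mk]
    filter_upwards [hU] with i hi
    rw [familyEval_of_mem _ hi, map_one, Pi.one_apply]
  map_zero' := by
    rw [← map_zero (UltraField.mk _ 𝒰), UltraField.mk_eq_mk]
    filter_upwards [hU] with i hi
    rw [familyEval_of_mem _ hi, map_zero, Pi.zero_apply]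
  map_mul' f g := by
    rw [← map_mul (UltraField.mk _ 𝒰), UltraField.mk_eq_mk]
    filter_upwards [hU] with i hi
    rw [Pi.mul_apply]
    simp only [familyEval_of_mem _ hi, map_mul]
  map_add' f g := by
    rw [← map_add (UltraField.mk _ 𝒰), UltraField.mk_eq_mk]
    filter_upwards [hU] with i hi
    rw [Pi.add_apply]
    simp only [familyEval_of_mem _ hi, map_add]

lemma ultraEval_apply {U : X.Opens} (hU : ∀ᶠ i in 𝒰, pt i ∈ U) (f : Γ(X, U)) :
    ultraEval U hU f = UltraField.mk _ 𝒰 (familyEval pt U f) := rfl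

lemma ultraEval_map {U V : X.Opens} (hU : ∀ᶠ i in 𝒰, pt i ∈ U) (hV : ∀ᶠ i in 𝒰, pt i ∈ V)
    (i : V ⟶ U) : (ultraEval V hV).comp (X.presheaf.map i.op).hom = ultraEval U hU := by
  ext f
  refine UltraField.mk_eq_mk.2 ?_
  filter_upwards [hV] with j hj
  rw [familyEval_of_mem _ hj, familyEval_of_mem _ (i.le hj)]
  exact evaluation_map i hj f

variable (pt 𝒰) in
/-- The base field in the ultraproduct of the residue fields. -/
def ultraBase : K →+* ultraResidue pt 𝒰 :=
  (UltraField.mk _ 𝒰).comp (RingHom.pi fun i => toResidue π (pt i))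

/-- The point of `X` with values in the ultraproduct of the residue fields. -/
def ultraPoint {U : X.Opens} (hU : IsAffineOpen U) (h : ∀ᶠ i in 𝒰, pt i ∈ U) :
    Spec (.of (ultraResidue pt 𝒰)) ⟶ X := specTo hU (ultraEval U h)

lemma ultraPoint_comp {U : X.Opens} (hU : IsAffineOpen U) (h : ∀ᶠ i in 𝒰, pt i ∈ U) :
    ultraPoint hU h ≫ π = Spec.map (CommRingCat.ofHom (ultraBase π pt 𝒰)) := by
  rw [ultraPoint, specTo_comp]
  congr 1
  ext a
  refine UltraField.mk_eq_mk.2 ?_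
  filter_upwards [h] with i hi
  exact (familyEval_of_mem _ hi).trans (evaluation_map (homOfLE le_top) hi _)

lemma ultraPoint_of_le {U V : X.Opens} (hU : IsAffineOpen U) (h : ∀ᶠ i in 𝒰, pt i ∈ U)
    (hV : IsAffineOpen V) (h' : ∀ᶠ i in 𝒰, pt i ∈ V) (i : V ⟶ U) :
    ultraPoint hU h = ultraPoint hV h' := by
  rw [ultraPoint, ← ultraEval_map h h' i, specTo_of_le, ultraPoint]

variable (abv : ∀ i, AbsoluteValue (X.residueField (pt i)) ℝ)

/-- The ring of bounded families. -/
abbrev ultraRing : ValuationSubring (ultraResidue pt 𝒰) := UltraField.bounded 𝒰 abv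

variable {α : K → ℝ} (hα : ∀ i a, abv i (toResidue π (pt i) a) = α a)

include hα in
lemma ultraBase_mem (a : K) : ultraBase π pt 𝒰 a ∈ ultraRing (𝒰 := 𝒰) abv :=
  (UltraField.mk_mem_bounded abv).2 ⟨α a, Eventually.of_forall fun i => (hα i a).le⟩

/-- The structural homomorphism of the ring of bounded families. -/
def ultraRingBase : K →+* ultraRing (𝒰 := 𝒰) abv :=
  (ultraBase π pt 𝒰).codRestrict _ (ultraBase_mem π abv hα)

/-- A morphism from the spectrum of the ring of bounded families to `X` that is generically given
by the family of points. -/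
def IsUltraLimit (l : Spec (.of (ultraRing (𝒰 := 𝒰) abv)) ⟶ X) : Prop :=
  ∀ (V : X.Opens) (h : l (IsLocalRing.closedPoint _) ∈ V), ∃ hV : ∀ᶠ i in 𝒰, pt i ∈ V,
    ∀ f, ultraEval V hV f = (localEval l V h f).1

lemma isAffineOpen_inf [IsSeparated π] {U V : X.Opens} (hU : IsAffineOpen U)
    (hV : IsAffineOpen V) : IsAffineOpen (U ⊓ V) :=
  isAffineHom_diagonal_iff (f := π).1 inferInstance ⊤ (isAffineOpen_top _) U le_top V le_top hU hV

/-- Both morphisms restrict to the same one on `U ⊓ V`, which contains almost all the points and is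
affine because `π` is separated. -/
lemma ultraPoint_eq [IsSeparated π] {U V : X.Opens} (hU : IsAffineOpen U)
    (h : ∀ᶠ i in 𝒰, pt i ∈ U) (hV : IsAffineOpen V) (h' : ∀ᶠ i in 𝒰, pt i ∈ V) :
    ultraPoint hU h = ultraPoint hV h' := by
  have h'' : ∀ᶠ i in 𝒰, pt i ∈ U ⊓ V := h.and h'
  have hUV := isAffineOpen_inf π hU hV
  rw [ultraPoint_of_le hU h hUV h'' (homOfLE inf_le_left),
    ultraPoint_of_le hV h' hUV h'' (homOfLE inf_le_right)]

/-- When finitely many affine open sets cover `X`, the ultrafilter selects one of them. -/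
lemma exists_affine_eventually [CompactSpace X] :
    ∃ U : X.Opens, IsAffineOpen U ∧ ∀ᶠ i in 𝒰, pt i ∈ U := by
  have h1 : ∀ x : X, ∃ U : X.Opens, IsAffineOpen U ∧ x ∈ U := fun x =>
    have ⟨U, hU, hxU, _⟩ := exists_isAffineOpen_mem_and_subset (U := ⊤) (x := x) trivial
    ⟨U, hU, hxU⟩
  choose U hU hxU using h1
  obtain ⟨t, ht⟩ := isCompact_univ.elim_finite_subcover (fun x => (U x : Set X))
    (fun x => (U x).isOpen) (fun x _ => Set.mem_iUnion.2 ⟨x, hxU x⟩)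
  have h2 : (⋃ x ∈ (t : Set X), {i | pt i ∈ U x}) ∈ 𝒰 := by
    refine univ_mem' fun i => ?_
    obtain ⟨x, hx, hi⟩ := Set.mem_iUnion₂.1 (ht (Set.mem_univ (pt i)))
    exact Set.mem_iUnion₂.2 ⟨x, hx, hi⟩
  obtain ⟨x, -, hx⟩ := (Ultrafilter.finite_biUnion_mem_iff t.finite_toSet).1 h2
  exact ⟨U x, hU x, hx⟩

lemma localEval_map {R : Type u} [CommRing R] [IsLocalRing R] (l : Spec (.of R) ⟶ X)
    {V W : X.Opens} (i : W ⟶ V) (h : l (IsLocalRing.closedPoint R) ∈ W) (f : Γ(X, V)) :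
    localEval l W h (X.presheaf.map i.op f) = localEval l V (i.le h) f := by
  change (Scheme.stalkClosedPointTo l).hom (X.presheaf.germ W _ h (X.presheaf.map i.op f)) =
    (Scheme.stalkClosedPointTo l).hom (X.presheaf.germ V _ (i.le h) f)
  rw [TopCat.Presheaf.germ_res_apply]

/-- The generic point specialises to the closed point, so an open set around the limit contains the
image of the generic point, hence almost all the points of the family. -/
lemma isUltraLimit_of_generic [IsSeparated π] {U : X.Opens} (hU : IsAffineOpen U)
    (hU' : ∀ᶠ i in 𝒰, pt i ∈ U) (l : Spec (.of (ultraRing (𝒰 := 𝒰) abv)) ⟶ X)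
    (hl : Spec.map (CommRingCat.ofHom (algebraMap (ultraRing (𝒰 := 𝒰) abv) _)) ≫ l =
      ultraPoint hU hU') : IsUltraLimit abv l := by
  have key : ∀ (V : X.Opens) (h : l (IsLocalRing.closedPoint _) ∈ V), IsAffineOpen V →
      ∃ hV : ∀ᶠ i in 𝒰, pt i ∈ V, ∀ f, ultraEval V hV f = (localEval l V h f).1 := by
    intro V h hV
    have h1 : specTo hV ((algebraMap (ultraRing (𝒰 := 𝒰) abv) (ultraResidue pt 𝒰)).comp
        (localEval l V h)) = ultraPoint hU hU' := by
      rw [← specTo_comp_map, specTo_localEval, hl]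
    have h2 : ultraPoint hU hU' (IsLocalRing.closedPoint _) ∈ V := by
      rw [← h1]
      exact specTo_closedPoint_mem _ _
    -- The function `a` has non-zero class in the ultraproduct, so it is non-zero at almost all the
    -- points; these lie in the basic open set of `a`, which is contained in `V`.
    obtain ⟨a, ha, ha'⟩ := hU.exists_basicOpen_le ⟨_, h2⟩ (specTo_closedPoint_mem _ _)
    have h3 := (specTo_closedPoint_mem_basicOpen _ _ _).1 ha'
    have h4 : ∀ᶠ i in 𝒰, pt i ∈ V := by
      have h5 := Ultrafilter.eventually_not.2 (fun h0 => h3.ne_zero (UltraField.mk_eq_zero.2 h0))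
      filter_upwards [h5, hU'] with i h6 h7
      rw [familyEval_of_mem _ h7] at h6
      exact ha ((X.evaluation_ne_zero_iff_mem_basicOpen _ _ _).1 h6)
    refine ⟨h4, fun f => ?_⟩
    rw [ultraPoint_eq π hU hU' hV h4, ultraPoint] at h1
    exact (DFunLike.congr_fun (specTo_injective hV h1) f).symm
  intro V h
  obtain ⟨W, hW, hxW, hWV⟩ := exists_isAffineOpen_mem_and_subset h
  obtain ⟨h1, h2⟩ := key W hxW hW
  have h3 : ∀ᶠ i in 𝒰, pt i ∈ V := h1.mono fun i hi => hWV hi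
  refine ⟨h3, fun f => ?_⟩
  rw [← ultraEval_map h3 h1 (homOfLE hWV), ← localEval_map l (homOfLE hWV) hxW]
  exact h2 _

-- Existence in the valuative criterion. All the absolute values restrict to the same `α` on `K`, so
-- `K` lies in the ring of bounded families and the valuative square commutes.
include hα in
lemma exists_isUltraLimit [IsProper π] :
    ∃ l : Spec (.of (ultraRing (𝒰 := 𝒰) abv)) ⟶ X, IsUltraLimit abv l := by
  have : CompactSpace X := QuasiCompact.compactSpace_of_compactSpace π
  obtain ⟨U, hU, hU'⟩ := exists_affine_eventually (pt := pt) (𝒰 := 𝒰)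
  have hex : ValuativeCriterion.Existence π := by
    have := (UniversallyClosed.eq_valuativeCriterion ▸ (inferInstance : UniversallyClosed π) :
      (ValuativeCriterion.Existence ⊓ @QuasiCompact) π)
    exact this.1
  let S : ValuativeCommSq π :=
    { R := ultraRing (𝒰 := 𝒰) abv
      K := ultraResidue pt 𝒰
      i₁ := ultraPoint hU hU'
      i₂ := Spec.map (CommRingCat.ofHom (ultraRingBase π abv hα))
      commSq := ⟨by
        rw [ultraPoint_comp, ← Spec.map_comp]
        rfl⟩ }
  obtain ⟨⟨l⟩⟩ := hex S
  exact ⟨l.l, isUltraLimit_of_generic π abv hU hU' l.l l.fac_left⟩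

-- Uniqueness in the valuative criterion: both sides are lifts in one and the same square.
include hα in
lemma specTo_eq_specTo [IsSeparated π] {V W : X.Opens} (hV : IsAffineOpen V)
    (hW : IsAffineOpen W) (hV' : ∀ᶠ i in 𝒰, pt i ∈ V) (hW' : ∀ᶠ i in 𝒰, pt i ∈ W)
    (φ : Γ(X, V) →+* ultraRing (𝒰 := 𝒰) abv) (ψ : Γ(X, W) →+* ultraRing (𝒰 := 𝒰) abv)
    (hφ : ∀ f, (φ f).1 = ultraEval V hV' f) (hψ : ∀ f, (ψ f).1 = ultraEval W hW' f) :
    specTo hV φ = specTo hW ψ := by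
  have huniq : ValuativeCriterion.Uniqueness π := by
    have := (IsSeparated.eq_valuativeCriterion ▸ (inferInstance : IsSeparated π) :
      (ValuativeCriterion.Uniqueness ⊓ @QuasiSeparated) π)
    exact this.1
  let S : ValuativeCommSq π :=
    { R := ultraRing (𝒰 := 𝒰) abv
      K := ultraResidue pt 𝒰
      i₁ := ultraPoint hV hV'
      i₂ := Spec.map (CommRingCat.ofHom (ultraRingBase π abv hα))
      commSq := ⟨by
        rw [ultraPoint_comp, ← Spec.map_comp]
        rfl⟩ }
  have hleft : ∀ {V : X.Opens} (hV : IsAffineOpen V) (hV' : ∀ᶠ i in 𝒰, pt i ∈ V)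
      (φ : Γ(X, V) →+* ultraRing (𝒰 := 𝒰) abv) (hφ : ∀ f, (φ f).1 = ultraEval V hV' f),
      Spec.map (CommRingCat.ofHom (algebraMap (ultraRing (𝒰 := 𝒰) abv) (ultraResidue pt 𝒰))) ≫
        specTo hV φ = ultraPoint hV hV' := by
    intro V hV hV' φ hφ
    rw [specTo_comp_map, ultraPoint]
    congr 1
    exact RingHom.ext hφ
  have hright : ∀ {V : X.Opens} (hV : IsAffineOpen V) (hV' : ∀ᶠ i in 𝒰, pt i ∈ V)
      (φ : Γ(X, V) →+* ultraRing (𝒰 := 𝒰) abv) (hφ : ∀ f, (φ f).1 = ultraEval V hV' f),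
      specTo hV φ ≫ π = Spec.map (CommRingCat.ofHom (ultraRingBase π abv hα)) := by
    intro V hV hV' φ hφ
    have h1 := ultraPoint_comp π hV hV'
    rw [ultraPoint, specTo_comp] at h1
    rw [specTo_comp]
    congr 1
    ext a
    have h2 := congrArg (fun g => g.hom a) (Spec.map_injective h1)
    exact (hφ (X.presheaf.map (homOfLE le_top).op
      (π.appTop ((Scheme.ΓSpecIso (.of K)).inv a)))).trans h2
  let l₁ : S.commSq.LiftStruct := ⟨specTo hV φ, hleft hV hV' φ hφ, hright hV hV' φ hφ⟩
  let l₂ : S.commSq.LiftStruct := ⟨specTo hW ψ, (hleft hW hW' ψ hψ).trans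
    (ultraPoint_eq π hW hW' hV hV'), hright hW hW' ψ hψ⟩
  exact congrArg CommSq.LiftStruct.l ((huniq S).elim l₁ l₂)

/-- The family of points with absolute values converges to the point `z` with the absolute value
`b`. -/
def TendstoPoint (𝒰 : Ultrafilter ι) {z : X} (b : AbsoluteValue (X.residueField z) ℝ) : Prop :=
  ∀ (U : X.Opens) (h : z ∈ U), (∀ᶠ i in 𝒰, pt i ∈ U) ∧ ∀ f : Γ(X, U),
    Tendsto (fun i => abv i (familyEval pt U f i)) 𝒰 (nhds (b (X.evaluation U z h f)))

variable {abv}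

/-- Convergent values are bounded almost everywhere, so functions on an affine neighbourhood of `z`
take values in the bounded ring. The closed point goes to `z`, since `f` is non-zero at `z` exactly
when its limit absolute value is non-zero, that is, when its image is a unit. -/
lemma TendstoPoint.exists_specTo {z : X} {b : AbsoluteValue (X.residueField z) ℝ}
    (hz : TendstoPoint abv 𝒰 b) :
    ∃ (V : X.Opens) (hV : IsAffineOpen V) (hV' : ∀ᶠ i in 𝒰, pt i ∈ V)
      (φ : Γ(X, V) →+* ultraRing (𝒰 := 𝒰) abv),
      (∀ f, (φ f).1 = ultraEval V hV' f) ∧ specTo hV φ (IsLocalRing.closedPoint _) = z := by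
  obtain ⟨V, hV, hzV, -⟩ := exists_isAffineOpen_mem_and_subset (U := ⊤) (x := z) trivial
  obtain ⟨h1, h2⟩ := hz V hzV
  have h3 : ∀ f, ultraEval V h1 f ∈ ultraRing (𝒰 := 𝒰) abv := fun f =>
    (UltraField.mk_mem_bounded abv).2
      ⟨b (X.evaluation V z hzV f) + 1, (h2 f).eventually_le_const (lt_add_one _)⟩
  refine ⟨V, hV, h1, (ultraEval V h1).codRestrict _ h3, fun f => rfl, ?_⟩
  refine eq_of_mem_basicOpen_iff hV (specTo_closedPoint_mem _ _) hzV fun f => ?_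
  rw [specTo_closedPoint_mem_basicOpen, UltraField.isUnit_iff_stdAbs_ne_zero,
    ← X.evaluation_ne_zero_iff_mem_basicOpen z hzV, ← b.ne_zero_iff]
  have h4 := UltraField.stdAbs_eq (h3 f) (h2 f)
  exact not_congr (Eq.congr_left h4)

include hα in
lemma TendstoPoint.unique [IsSeparated π] {z z' : X} {b : AbsoluteValue (X.residueField z) ℝ}
    {b' : AbsoluteValue (X.residueField z') ℝ} (hz : TendstoPoint abv 𝒰 b)
    (hz' : TendstoPoint abv 𝒰 b') : z = z' := by
  obtain ⟨V, hV, hV', φ, hφ, rfl⟩ := hz.exists_specTo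
  obtain ⟨W, hW, hW', ψ, hψ, rfl⟩ := hz'.exists_specTo
  rw [specTo_eq_specTo π abv hα hV hW hV' hW' φ ψ hφ hψ]

end Limit


/-! ### Morphisms from spectra of local rings to a scheme -/

/-! ### Compactness and separation of `X_v^an` -/

section Compact

variable {K : Type u} [Field K] [NumberField K] {X : Scheme.{u}} (π : X ⟶ Spec (.of K))

/-- The elements of the base field as global functions. -/
def baseFun (a : K) : Γ(X, ⊤) := π.appTop ((Scheme.ΓSpecIso (.of K)).inv a)

lemma familyEval_baseFun {ι : Type u} {pt : ι → X} (i : ι) (a : K) :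
    familyEval pt ⊤ (baseFun π a) i = toResidue π (pt i) a := familyEval_of_mem (U := ⊤) _ trivial

section Limit

variable {ι : Type u} {pt : ι → X} (𝒰 : Ultrafilter ι)

lemma IsUltraLimit.exists_localEval_eq {abv : ∀ i, AbsoluteValue (X.residueField (pt i)) ℝ}
    {l : Spec (.of (ultraRing (𝒰 := 𝒰) abv)) ⟶ X} (hl : IsUltraLimit abv l) {U : X.Opens}
    (h : l (IsLocalRing.closedPoint _) ∈ U) (f : Γ(X, U)) :
    ∃ h1 : UltraField.mk _ 𝒰 (familyEval pt U f) ∈ UltraField.bounded 𝒰 abv,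
      localEval l U h f = ⟨UltraField.mk _ 𝒰 (familyEval pt U f), h1⟩ := by
  obtain ⟨h1, h2⟩ := hl U h
  have h3 := h2 f
  rw [ultraEval_apply] at h3
  exact ⟨h3 ▸ Subtype.prop _, Subtype.ext h3.symm⟩

/-- The limit is the image of the closed point; its residue field embeds in that of the bounded
ring, from which it inherits `residueAbs`. -/
lemma exists_tendstoPoint [IsProper π] (abv : ∀ i, AbsoluteValue (X.residueField (pt i)) ℝ)
    {α : K → ℝ} (hα : ∀ i a, abv i (toResidue π (pt i) a) = α a) :
    ∃ (z : X) (b : AbsoluteValue (X.residueField z) ℝ), TendstoPoint abv 𝒰 b := by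
  obtain ⟨l, hl⟩ := exists_isUltraLimit (𝒰 := 𝒰) π abv hα
  refine ⟨l (IsLocalRing.closedPoint _),
    (UltraField.residueAbs 𝒰 abv).comp (localResidue l).injective, fun U h => ⟨(hl U h).1, ?_⟩⟩
  intro f
  obtain ⟨h1, h2⟩ := hl.exists_localEval_eq 𝒰 h f
  have h3 : UltraField.residueAbs 𝒰 abv (localResidue l (X.evaluation U _ h f)) =
      UltraField.stdAbs ⟨UltraField.mk _ 𝒰 (familyEval pt U f), h1⟩ := by
    rw [← UltraField.residueAbs_residue, ← h2]
    rfl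
  have h4 := UltraField.tendsto_stdAbs h1
  rw [← h3] at h4
  exact h4

lemma exists_tendsto_embedding [IsProper π] (e : ∀ i, X.residueField (pt i) →+* ℂ)
    {σ : K →+* ℂ} (hσ : ∀ i a, e i (toResidue π (pt i) a) = σ a) :
    ∃ (z : X) (b : X.residueField z →+* ℂ), ∀ (U : X.Opens) (h : z ∈ U),
      (∀ᶠ i in 𝒰, pt i ∈ U) ∧ ∀ f : Γ(X, U),
        Tendsto (fun i => e i (familyEval pt U f i)) 𝒰 (nhds (b (X.evaluation U z h f))) := by
  obtain ⟨l, hl⟩ := exists_isUltraLimit (𝒰 := 𝒰) π (UltraField.complexAbs e)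
    (α := fun a => ‖σ a‖) (fun i a => congrArg norm (hσ i a))
  refine ⟨l (IsLocalRing.closedPoint _),
    (UltraField.residueHom 𝒰 e).comp (localResidue l), fun U h => ⟨(hl U h).1, ?_⟩⟩
  intro f
  obtain ⟨h1, h2⟩ := hl.exists_localEval_eq 𝒰 h f
  have h3 : UltraField.residueHom 𝒰 e (localResidue l (X.evaluation U _ h f)) =
      UltraField.stdFun e ⟨UltraField.mk _ 𝒰 (familyEval pt U f), h1⟩ := by
    refine Eq.trans ?_ (UltraField.residueHom_residue _)
    rw [← h2]
    rfl
  have h4 := UltraField.tendsto_stdFun h1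
  rw [← h3] at h4
  exact h4

end Limit

section Finite

variable (p : HeightOneSpectrum (𝓞 K))

lemma BerkovichPoint.le_nhds_iff (𝒰 : Filter (BerkovichPoint π p)) (y : BerkovichPoint π p) :
    𝒰 ≤ nhds y ↔ ∀ (U : X.Opens) (h : y.pt ∈ U), (∀ᶠ z in 𝒰, z.pt ∈ U) ∧ ∀ f : Γ(X, U),
      Tendsto (fun z : BerkovichPoint π p => z.abv (familyEval BerkovichPoint.pt U f z)) 𝒰
        (nhds (y.abv (X.evaluation U y.pt h f))) := by
  rw [TopologicalSpace.nhds_generateFrom, le_iInf₂_iff]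
  constructor
  · intro H U h
    have h1 : ∀ (f : Γ(X, U)) (W : Set ℝ), IsOpen W → y.abv (X.evaluation U y.pt h f) ∈ W →
        ∀ᶠ z in 𝒰, ∃ h : z.pt ∈ U, z.abv (X.evaluation U z.pt h f) ∈ W := fun f W hW hy =>
      le_principal_iff.1 (H _ ⟨⟨h, hy⟩, U, f, W, hW, rfl⟩)
    -- Taking `f = 0` and `W = univ` in the subbasis gives the set `U^an` itself.
    refine ⟨(h1 0 Set.univ isOpen_univ trivial).mono fun z hz => hz.1, fun f => ?_⟩
    refine tendsto_nhds.2 fun W hW hy => ?_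
    filter_upwards [h1 f W hW hy] with z ⟨hz, hz'⟩
    rw [Set.mem_preimage, familyEval_of_mem _ hz]
    exact hz'
  · rintro H _ ⟨hy, U, f, W, hW, rfl⟩
    obtain ⟨h, hy⟩ := hy
    rw [le_principal_iff]
    obtain ⟨h1, h2⟩ := H U h
    filter_upwards [h1, (h2 f).eventually (hW.mem_nhds hy)] with z hz hz'
    refine ⟨hz, ?_⟩
    rwa [familyEval_of_mem _ hz] at hz'

/-- The space indexes its own points, so every ultrafilter on it has a limit. Testing the limit on
constant functions shows that its absolute value extends the one of `K`. -/
instance [IsProper π] : CompactSpace (BerkovichPoint π p) where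
  isCompact_univ := by
    refine isCompact_iff_ultrafilter_le_nhds.2 fun 𝒰 _ => ?_
    obtain ⟨z, b, hb⟩ := exists_tendstoPoint π 𝒰 BerkovichPoint.abv
      (fun y : BerkovichPoint π p => y.abv_base)
    refine ⟨⟨z, b, fun a => ?_⟩, trivial, (BerkovichPoint.le_nhds_iff π p 𝒰 _).2 hb⟩
    obtain ⟨h1, h2⟩ := hb ⊤ trivial
    have h3 := h2 (baseFun π a)
    refine tendsto_nhds_unique h3 (tendsto_const_nhds.congr fun y => ?_)
    rw [familyEval_baseFun, y.abv_base]

/-- Two limits have the same underlying point of `X`. Their absolute values then agree, as each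
element of the residue field is the value of a function defined nearby. -/
instance [IsSeparated π] : T2Space (BerkovichPoint π p) := by
  refine t2_iff_ultrafilter.2 fun {y z} 𝒰 hy hz => ?_
  rw [BerkovichPoint.le_nhds_iff] at hy hz
  have h := TendstoPoint.unique π (fun y : BerkovichPoint π p => y.abv_base)
    (𝒰 := 𝒰) (b := y.abv) (b' := z.abv) hy hz
  obtain ⟨y, b, hb⟩ := y
  obtain ⟨z, c, hc⟩ := z
  obtain rfl : y = z := h
  congr 1
  ext a
  obtain ⟨U, hU, f, rfl⟩ := exists_evaluation_eq a
  exact tendsto_nhds_unique ((hy U hU).2 f) ((hz U hU).2 f)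

end Finite

section Infinite

variable (σ : K →+* ℂ)

lemma ComplexPoint.le_nhds_iff (𝒰 : Filter (ComplexPoint π σ)) (y : ComplexPoint π σ) :
    𝒰 ≤ nhds y ↔ ∀ (U : X.Opens) (h : y.pt ∈ U), (∀ᶠ z in 𝒰, z.pt ∈ U) ∧ ∀ f : Γ(X, U),
      Tendsto (fun z : ComplexPoint π σ => z.emb (familyEval ComplexPoint.pt U f z)) 𝒰
        (nhds (y.emb (X.evaluation U y.pt h f))) := by
  rw [TopologicalSpace.nhds_generateFrom, le_iInf₂_iff]
  constructor
  · intro H U h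
    have h1 : ∀ (f : Γ(X, U)) (W : Set ℂ), IsOpen W → y.emb (X.evaluation U y.pt h f) ∈ W →
        ∀ᶠ z in 𝒰, ∃ h : z.pt ∈ U, z.emb (X.evaluation U z.pt h f) ∈ W := fun f W hW hy =>
      le_principal_iff.1 (H _ ⟨⟨h, hy⟩, U, f, W, hW, rfl⟩)
    refine ⟨(h1 0 Set.univ isOpen_univ trivial).mono fun z hz => hz.1, fun f => ?_⟩
    refine tendsto_nhds.2 fun W hW hy => ?_
    filter_upwards [h1 f W hW hy] with z ⟨hz, hz'⟩
    rw [Set.mem_preimage, familyEval_of_mem _ hz]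
    exact hz'
  · rintro H _ ⟨hy, U, f, W, hW, rfl⟩
    obtain ⟨h, hy⟩ := hy
    rw [le_principal_iff]
    obtain ⟨h1, h2⟩ := H U h
    filter_upwards [h1, (h2 f).eventually (hW.mem_nhds hy)] with z hz hz'
    refine ⟨hz, ?_⟩
    rwa [familyEval_of_mem _ hz] at hz'

lemma ComplexPoint.abv_base (y : ComplexPoint π σ) (a : K) :
    UltraField.complexAbs (fun y : ComplexPoint π σ => y.emb) y (toResidue π y.pt a) = ‖σ a‖ :=
  congrArg norm (RingHom.congr_fun y.emb_base a)

instance [IsProper π] : CompactSpace (ComplexPoint π σ) where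
  isCompact_univ := by
    refine isCompact_iff_ultrafilter_le_nhds.2 fun 𝒰 _ => ?_
    obtain ⟨z, b, hb⟩ := exists_tendsto_embedding π 𝒰 ComplexPoint.emb
      (fun (y : ComplexPoint π σ) a => RingHom.congr_fun y.emb_base a)
    refine ⟨⟨z, b, RingHom.ext fun a => ?_⟩, trivial,
      (ComplexPoint.le_nhds_iff π σ 𝒰 _).2 hb⟩
    obtain ⟨h1, h2⟩ := hb ⊤ trivial
    have h3 := h2 (baseFun π a)
    refine tendsto_nhds_unique h3 (tendsto_const_nhds.congr fun y => ?_)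
    rw [familyEval_baseFun]
    exact (RingHom.congr_fun y.emb_base a).symm

instance [IsSeparated π] : T2Space (ComplexPoint π σ) := by
  refine t2_iff_ultrafilter.2 fun {y z} 𝒰 hy hz => ?_
  rw [ComplexPoint.le_nhds_iff] at hy hz
  -- The moduli of the values suffice to identify the underlying point; the values themselves are
  -- needed only to identify the embedding.
  have h := TendstoPoint.unique π (ComplexPoint.abv_base π σ) (𝒰 := 𝒰)
    (b := UltraField.complexAbs (fun y : ComplexPoint π σ => y.emb) y)
    (b' := UltraField.complexAbs (fun y : ComplexPoint π σ => y.emb) z)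
    (fun U hU => ⟨(hy U hU).1, fun f => ((hy U hU).2 f).norm⟩)
    (fun U hU => ⟨(hz U hU).1, fun f => ((hz U hU).2 f).norm⟩)
  obtain ⟨y, b, hb⟩ := y
  obtain ⟨z, c, hc⟩ := z
  obtain rfl : y = z := h
  congr 1
  ext a
  obtain ⟨U, hU, f, rfl⟩ := exists_evaluation_eq a
  exact tendsto_nhds_unique ((hy U hU).2 f) ((hz U hU).2 f)

end Infinite

instance [IsProper π] : ∀ v : Place K, CompactSpace (An π v)
  | .finite p => inferInstanceAs (CompactSpace (BerkovichPoint π p))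
  | .infinite σ => inferInstanceAs (CompactSpace (ComplexPoint π σ))

instance [IsSeparated π] : ∀ v : Place K, T2Space (An π v)
  | .finite p => inferInstanceAs (T2Space (BerkovichPoint π p))
  | .infinite σ => inferInstanceAs (T2Space (ComplexPoint π σ))

end Compact


/-! ### Morphisms from spectra of local rings to a scheme -/

/-! ### Number fields: the product formula and the fundamental identity -/

namespace HeightOne

variable (K : Type u) [Field K] [NumberField K] {L : Type u} [Field L] [NumberField L]
  [Algebra K L]

lemma resChar_under_pow_resDegree (w : HeightOneSpectrum (𝓞 L)) :
    resChar (w.under (𝓞 K)) ^ resDegree w = Ideal.absNorm w.asIdeal := by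
  have := w.isPrime
  have h : w.asIdeal.LiesOver ((w.asIdeal.under (𝓞 K)).under ℤ) :=
    ⟨by rw [Ideal.under_under]⟩
  exact @Ideal.absNorm_pow_inertiaDeg ℤ (𝓞 L) _ _ _ ((w.asIdeal.under (𝓞 K)).under ℤ) w.asIdeal
    _ _ h _ _ _ _

lemma resDegree_pos (p : HeightOneSpectrum (𝓞 K)) : 0 < resDegree p := by
  have := p.isPrime
  exact Ideal.inertiaDeg_pos _ _

lemma resDegree_eq (w : HeightOneSpectrum (𝓞 L)) :
    resDegree w = resDegree (w.under (𝓞 K)) * resIdx K w := by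
  have : w.asIdeal.LiesOver (w.under (𝓞 K)).asIdeal := ⟨rfl⟩
  exact Ideal.inertiaDeg_tower (R := ℤ) (S := 𝓞 K) (q := (w.under (𝓞 K)).asIdeal) (r := w.asIdeal)

/-- The exponent `1 / e(w|𝔭)` in `extAbs` cancels the power `e(w|𝔭)`, and `p ^ n_w` is the norm of
`w`. This translates to the normalisation of `FinitePlace`, for which the product formula is
available. -/
lemma extAbs_pow (w : HeightOneSpectrum (𝓞 L)) {b : L} (hb : b ≠ 0) :
    (extAbs K w b ^ ramIdx K w) ^ resDegree w = FinitePlace.mk w b := by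
  rw [FinitePlace.mk_apply, FinitePlace.norm_embedding]
  change (((WithZeroMulInt.toNNReal (ne_zero_of_lt (one_lt_extBase K w))
      (w.valuation L b) : ℝ≥0) : ℝ) ^ _) ^ _ =
    ((WithZeroMulInt.toNNReal (HeightOneSpectrum.absNorm_ne_zero w)
      (w.valuation L b) : ℝ≥0) : ℝ)
  norm_cast
  have hm : w.valuation L b ≠ 0 := (Valuation.ne_zero_iff _).2 hb
  rw [WithZeroMulInt.toNNReal_neg_apply _ hm, WithZeroMulInt.toNNReal_neg_apply _ hm, ← pow_mul,
    ← zpow_natCast, ← zpow_mul, mul_comm, zpow_mul, zpow_natCast]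
  congr 1
  have h0 : ((ramIdx K w : ℕ) : ℝ) ≠ 0 := by exact_mod_cast ramIdx_ne_zero K w
  rw [pow_mul, ← NNReal.rpow_mul_natCast, inv_mul_cancel₀ h0, NNReal.rpow_one]
  exact_mod_cast resChar_under_pow_resDegree K w

lemma resDegree_mul_log_extAbs (w : HeightOneSpectrum (𝓞 L)) {b : L} (hb : b ≠ 0) :
    (resDegree w : ℝ) * Real.log (extAbs K w b ^ ramIdx K w) = Real.log (FinitePlace.mk w b) := by
  rw [← extAbs_pow K w hb, Real.log_pow _ (resDegree w)]

lemma finite_mulSupport_mk {b : L} (hb : b ≠ 0) :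
    (Function.mulSupport fun w : HeightOneSpectrum (𝓞 L) => FinitePlace.mk w b).Finite := by
  have h := FinitePlace.hasFiniteMulSupport hb
  refine Set.Finite.of_finite_image (f := FinitePlace.mk) (h.subset ?_)
    (FinitePlace.equivHeightOneSpectrum.symm.injective.injOn)
  rintro _ ⟨w, hw, rfl⟩
  exact hw

lemma finite_support_log_extAbs {b : L} (hb : b ≠ 0) :
    (Function.support fun w : HeightOneSpectrum (𝓞 L) =>
      (resDegree w : ℝ) * Real.log (extAbs K w b ^ ramIdx K w)).Finite := by
  refine (finite_mulSupport_mk hb).subset fun w hw h => hw ?_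
  change (resDegree w : ℝ) * Real.log (extAbs K w b ^ ramIdx K w) = 0
  rw [resDegree_mul_log_extAbs K w hb]
  exact (congrArg Real.log h).trans Real.log_one

/-- The product formula. -/
lemma sum_log_extAbs_add_sum_log {b : L} (hb : b ≠ 0) :
    ∑ᶠ w : HeightOneSpectrum (𝓞 L), (resDegree w : ℝ) * Real.log (extAbs K w b ^ ramIdx K w) +
      ∑ τ : L →+* ℂ, Real.log ‖τ b‖ = 0 := by
  simp only [resDegree_mul_log_extAbs K _ hb]
  have hpos : ∀ w : HeightOneSpectrum (𝓞 L), FinitePlace.mk w b ≠ 0 := fun w =>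
    (FinitePlace.pos_iff.2 hb).ne'
  have h1 : ∑ᶠ w : HeightOneSpectrum (𝓞 L), Real.log (FinitePlace.mk w b) =
      Real.log (∏ᶠ w : HeightOneSpectrum (𝓞 L), FinitePlace.mk w b) := by
    have hs := finite_mulSupport_mk hb
    rw [finprod_eq_prod_of_mulSupport_subset (s := hs.toFinset) _ hs.coe_toFinset.ge,
      Real.log_prod (fun w _ => hpos w),
      finsum_eq_sum_of_support_subset (s := hs.toFinset)]
    intro w hw
    rw [hs.coe_toFinset]
    intro h
    exact hw ((congrArg Real.log h).trans Real.log_one)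
  have h2 : ∏ᶠ w : HeightOneSpectrum (𝓞 L), FinitePlace.mk w b = ∏ᶠ w : FinitePlace L, w b :=
    finprod_comp_equiv (f := fun w : FinitePlace L => w b)
      FinitePlace.equivHeightOneSpectrum.symm
  have h3 : ∏ τ : L →+* ℂ, ‖τ b‖ = |Algebra.norm ℚ b| := by
    have h := congrArg norm (Algebra.norm_eq_prod_embeddings ℚ ℂ b)
    rw [norm_prod, eq_ratCast, Complex.norm_ratCast] at h
    rw [Rat.cast_abs, h]
    exact Fintype.prod_equiv (RingHom.equivRatAlgHom L ℂ) _ _ fun τ => rfl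
  rw [h1, h2, FinitePlace.prod_eq_inv_abs_norm hb, ← Real.log_prod (fun τ _ => by simpa using hb),
    h3, Rat.cast_inv, Real.log_inv, neg_add_cancel]

/-- The primes of `L` above `p`. -/
def equivPrimesOver (p : HeightOneSpectrum (𝓞 K)) :
    {w : HeightOneSpectrum (𝓞 L) // w.under (𝓞 K) = p} ≃ p.asIdeal.primesOver (𝓞 L) where
  toFun w := ⟨w.1.asIdeal, w.1.isPrime, ⟨congrArg HeightOneSpectrum.asIdeal w.2.symm⟩⟩
  invFun q := ⟨⟨q.1, q.2.1, Ideal.ne_bot_of_mem_primesOver p.ne_bot q.2⟩,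
    HeightOneSpectrum.ext q.2.2.over.symm⟩
  left_inv _ := rfl
  right_inv _ := rfl

instance (p : HeightOneSpectrum (𝓞 K)) :
    Finite {w : HeightOneSpectrum (𝓞 L) // w.under (𝓞 K) = p} :=
  have := p.isMaximal
  .of_equiv _ (equivPrimesOver K p).symm

lemma sum_ramIdx_mul_resIdx (p : HeightOneSpectrum (𝓞 K))
    [Fintype {w : HeightOneSpectrum (𝓞 L) // w.under (𝓞 K) = p}] :
    ∑ w : {w : HeightOneSpectrum (𝓞 L) // w.under (𝓞 K) = p}, ramIdx K w.1 * resIdx K w.1 =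
      Module.finrank K L := by
  have := p.isMaximal
  have h := Ideal.sum_ramification_inertia_eq_finrank p.asIdeal (𝓞 L)
  rw [IsFractionRing.finrank_eq (𝓞 K) K (𝓞 L) L, ← h]
  exact Fintype.sum_equiv (equivPrimesOver K p) _ _ fun w => rfl

end HeightOne

/-- The number of extensions of an embedding in `ℂ`. -/
lemma card_extensions {K L : Type u} [Field K] [NumberField K] [Field L] [NumberField L]
    [Algebra K L] (σ : K →+* ℂ) [Fintype {τ : L →+* ℂ // τ.comp (algebraMap K L) = σ}] :
    Fintype.card {τ : L →+* ℂ // τ.comp (algebraMap K L) = σ} = Module.finrank K L := by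
  let := σ.toAlgebra
  rw [← AlgHom.card K L ℂ]
  exact Fintype.card_congr
    { toFun := fun τ => ⟨τ.1, fun a => RingHom.congr_fun τ.2 a⟩
      invFun := fun τ => ⟨τ.toRingHom, RingHom.ext τ.commutes⟩
      left_inv := fun _ => rfl
      right_inv := fun _ => rfl }


/-! ### Morphisms from spectra of local rings to a scheme -/

/-! ### The measures of algebraic points -/

lemma An.continuous_conj_cast {K : Type u} [Field K] [NumberField K] {X : Scheme.{u}}
    {π : X ⟶ Spec (.of K)} {v : Place K} (h : v.conj = v) :
    Continuous fun y : An π v => y.conj.cast h := by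
  have h1 : ∀ {w : Place K} (hw : w = v), Continuous (An.cast (π := π) hw) := by
    rintro _ rfl
    exact continuous_id
  exact (h1 h).comp (An.continuous_conj _)

namespace AlgPoint

variable {K : Type u} [Field K] [NumberField K] {X : Scheme.{u}} {π : X ⟶ Spec (.of K)}
  [IsProper π] (P : AlgPoint π)

lemma finrank_ne_zero : (Module.finrank K P.DefField : ℝ≥0∞) ≠ 0 :=
  Nat.cast_ne_zero.2 Module.finrank_pos.ne'

/-- At a finite place the total mass is computed by `∑ e f = [K(P) : K]`, at an infinite one by
counting the extensions of `σ` to `K(P)`. -/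
instance : ∀ v : Place K, IsProbabilityMeasure (P.measure v)
  | .finite p => ⟨by
      have := Fintype.ofFinite {w : HeightOneSpectrum (𝓞 P.DefField) // w.under (𝓞 K) = p}
      rw [measure, Measure.smul_apply, Measure.sum_apply _ .univ, tsum_fintype]
      simp only [Measure.smul_apply, measure_univ, smul_eq_mul, mul_one]
      rw [← Nat.cast_sum, HeightOne.sum_ramIdx_mul_resIdx]
      exact ENNReal.inv_mul_cancel P.finrank_ne_zero (ENNReal.natCast_ne_top _)⟩
  | .infinite σ => ⟨by
      have := Fintype.ofFinite {τ : P.DefField →+* ℂ // τ.comp (algebraMap K P.DefField) = σ}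
      rw [measure, Measure.smul_apply, Measure.sum_apply _ .univ, tsum_fintype]
      simp only [measure_univ, smul_eq_mul, Finset.sum_const, Finset.card_univ, card_extensions,
        nsmul_eq_mul, mul_one]
      exact ENNReal.inv_mul_cancel P.finrank_ne_zero (ENNReal.natCast_ne_top _)⟩

lemma integral_measure_finite (p : HeightOneSpectrum (𝓞 K))
    [Fintype {w : HeightOneSpectrum (𝓞 P.DefField) // w.under (𝓞 K) = p}]
    (f : C(An π (.finite p), ℝ)) :
    ∫ y, f y ∂(P.measure (.finite p)) = (Module.finrank K P.DefField : ℝ)⁻¹ *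
      ∑ w : {w : HeightOneSpectrum (𝓞 P.DefField) // w.under (𝓞 K) = p},
        (HeightOne.ramIdx K w.1 * HeightOne.resIdx K w.1 : ℝ) *
          f ((P.finitePoint w.1).cast (congrArg Place.finite w.2)) := by
  have hm := f.continuous.stronglyMeasurable
  rw [measure, integral_smul_measure, Measure.sum_fintype, integral_finsetSum_measure]
  · simp only [integral_smul_measure, integral_dirac' _ _ hm, ENNReal.toReal_inv,
      ENNReal.toReal_natCast, smul_eq_mul]
    push_cast
    rfl
  · intro w _
    exact (integrable_dirac (by simp)).smul_measure (ENNReal.natCast_ne_top _)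

lemma integral_measure_infinite (σ : K →+* ℂ)
    [Fintype {τ : P.DefField →+* ℂ // τ.comp (algebraMap K P.DefField) = σ}]
    (f : C(An π (.infinite σ), ℝ)) :
    ∫ y, f y ∂(P.measure (.infinite σ)) = (Module.finrank K P.DefField : ℝ)⁻¹ *
      ∑ τ : {τ : P.DefField →+* ℂ // τ.comp (algebraMap K P.DefField) = σ},
        f ((P.complexPoint τ.1).cast (congrArg Place.infinite τ.2)) := by
  have hm := f.continuous.stronglyMeasurable
  rw [measure, integral_smul_measure, Measure.sum_fintype, integral_finsetSum_measure]
  · simp only [integral_dirac' _ _ hm, ENNReal.toReal_inv, ENNReal.toReal_natCast, smul_eq_mul]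
  · intro τ _
    exact integrable_dirac (by simp)

lemma complexPoint_conj (τ : P.DefField →+* ℂ) {σ : K →+* ℂ}
    (h : (Place.infinite (τ.comp (algebraMap K P.DefField))).conj = Place.infinite σ)
    (h' : ((starRingEnd ℂ).comp τ).comp (algebraMap K P.DefField) = σ) :
    (P.complexPoint τ).conj.cast h =
      (P.complexPoint ((starRingEnd ℂ).comp τ)).cast (congrArg Place.infinite h') := by
  subst h'
  rfl

/-- Complex conjugation of embeddings in `ℂ`. -/
def conjEquiv (L : Type u) [Field L] : (L →+* ℂ) ≃ (L →+* ℂ) :=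
  Function.Involutive.toPerm (fun τ => (starRingEnd ℂ).comp τ)
    fun _ => RingHom.ext fun _ => Complex.conj_conj _

/-- For real `σ`, conjugation permutes the embeddings of `K(P)` that extend `σ`. At a finite place
conjugation is the identity. -/
lemma integral_measure_conj {v : Place K} (h : v.conj = v) (f : C(An π v, ℝ)) :
    ∫ y, f (y.conj.cast h) ∂(P.measure v) = ∫ y, f y ∂(P.measure v) := by
  cases v with
  | finite p => rfl
  | infinite σ =>
    have hσ : (starRingEnd ℂ).comp σ = σ := Place.infinite.inj h
    have := Fintype.ofFinite {τ : P.DefField →+* ℂ // τ.comp (algebraMap K P.DefField) = σ}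
    have h1 := P.integral_measure_infinite σ (f.comp ⟨_, An.continuous_conj_cast h⟩)
    have h2 := P.integral_measure_infinite σ f
    simp only [ContinuousMap.comp_apply, ContinuousMap.coe_mk] at h1
    rw [h1, h2]
    congr 1
    have hiff : ∀ τ : P.DefField →+* ℂ, τ.comp (algebraMap K P.DefField) = σ ↔
        (conjEquiv P.DefField τ).comp (algebraMap K P.DefField) = σ := by
      intro τ
      change _ ↔ ((starRingEnd ℂ).comp τ).comp (algebraMap K P.DefField) = σ
      rw [RingHom.comp_assoc]
      constructor
      · intro h3
        rw [h3, hσ]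
      · intro h3
        rw [← hσ, ← h3, ← RingHom.comp_assoc]
        exact RingHom.ext fun a => (Complex.conj_conj _).symm
    refine Fintype.sum_equiv ((conjEquiv P.DefField).subtypeEquiv hiff) _ _ fun τ => ?_
    obtain ⟨τ, rfl⟩ := τ
    exact congrArg f (P.complexPoint_conj τ h ((hiff τ).1 rfl))

end AlgPoint

/-! ### Heights -/

section Height

variable {K : Type u} [Field K] [NumberField K] {X : Scheme.{u}} {π : X ⟶ Spec (.of K)}

namespace AdelicLineBundle

/-- The adelic line bundle `L` has a global basis with the norms `exp (-g_v)`. -/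
def HasWeight (L : AdelicLineBundle π) (g : ∀ v : Place K, An π v → ℝ) : Prop :=
  ∃ s : Γ(L.sheaf, ⊤), IsGenerator L.sheaf ⊤ s ∧
    ∀ (v : Place K) (y : An π v) (h : y.pt ∈ (⊤ : X.Opens)),
      L.norm v ⊤ s y h = Real.exp (-g v y)

lemma HasWeight.tensor {L M P : AdelicLineBundle π} {g g' : ∀ v : Place K, An π v → ℝ}
    (hL : L.HasWeight g) (hM : M.HasWeight g') (hP : L.IsTensorProduct M P) :
    P.HasWeight fun v y => g v y + g' v y := by
  obtain ⟨s, hs, hs'⟩ := hL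
  obtain ⟨t, ht, ht'⟩ := hM
  obtain ⟨μ, -, h2, h3⟩ := hP
  refine ⟨μ ⊤ s t, h2 _ _ _ hs ht, fun v y h => ?_⟩
  rw [h3, hs', ht', ← Real.exp_add, neg_add]

lemma HasWeight.of_isometric {L M : AdelicLineBundle π} {g : ∀ v : Place K, An π v → ℝ}
    (hM : M.HasWeight g) (h : L.Isometric M) : L.HasWeight g := by
  obtain ⟨s, hs, hs'⟩ := hM
  obtain ⟨φ, hφ⟩ := h
  refine ⟨φ.inv.app ⊤ s, fun V i => ?_, fun v y h => ?_⟩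
  · have h1 : (fun a : Γ(X, V) => a • (L.sheaf.presheaf.map i.op (φ.inv.app ⊤ s) : Γ(L.sheaf, V))) =
        (φ.inv.app V) ∘ fun a => a • (M.sheaf.presheaf.map i.op s : Γ(M.sheaf, V)) := by
      funext a
      rw [Function.comp_apply, Scheme.Modules.Hom.app_smul]
      exact congrArg _ (NatTrans.naturality_apply φ.inv.mapPresheaf i.op s).symm
    rw [h1]
    refine Function.Bijective.comp ?_ (hs V i)
    exact ConcreteCategory.bijective_of_isIso (φ.inv.app V)
  · rw [← hs' v y h, ← hφ]
    congr 1
    have h2 : φ.inv ≫ φ.hom = 𝟙 _ := φ.inv_hom_id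
    have h3 := congrArg (fun ψ => ψ.app ⊤ s) h2
    exact h3

lemma hasWeight_twist (v : Place K) (f : C(An π v, ℝ)) (hf : IsConjInvariant f) :
    (twist v f hf).HasWeight (twistFun v f) := by
  refine ⟨unitSection X ⊤, isGenerator_unitSection ⊤, fun w y h => ?_⟩
  change An.abv y (X.evaluation ⊤ y.pt _ (1 : Γ(X, ⊤))) * Real.exp (-twistFun v f w y) = _
  rw [map_one, map_one, one_mul]

/-- Every basis is, up to an invertible function, the restriction of the global one. -/
lemma HasWeight.exists_unit {L : AdelicLineBundle π} {g : ∀ v : Place K, An π v → ℝ}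
    (hL : L.HasWeight g) {U : X.Opens} {r : Γ(L.sheaf, U)} (hr : IsGenerator L.sheaf U r) :
    ∃ c : Γ(X, U), IsUnit c ∧ ∀ (v : Place K) (y : An π v) (h : y.pt ∈ U),
      L.norm v U r y h = y.absEval U h c * Real.exp (-g v y) := by
  obtain ⟨s, hs, hs'⟩ := hL
  obtain ⟨c, hc⟩ := (hs U (homOfLE le_top)).2 r
  have hr' : (L.sheaf.presheaf.map (𝟙 U).op r : Γ(L.sheaf, U)) = r := by
    rw [op_id, L.sheaf.presheaf.map_id]
    rfl
  obtain ⟨d, hd⟩ := (hr U (𝟙 U)).2 (L.sheaf.presheaf.map (homOfLE le_top).op s)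
  have hcd : c * d = 1 := by
    refine (hr U (𝟙 U)).1 ?_
    dsimp only at hc hd ⊢
    rw [mul_smul, hd, hc, one_smul, hr']
  refine ⟨c, IsUnit.of_mul_eq_one _ hcd, fun v y h => ?_⟩
  have h1 := (L.metric v).norm_smul U c (L.sheaf.presheaf.map (homOfLE le_top).op s) y h
  rw [(L.metric v).norm_res] at h1
  dsimp only at hc
  rw [hc] at h1
  exact h1.trans (congrArg _ (hs' v y _))

variable [IsProper π]

/-- The basis chosen in `height` differs from the global one by a unit `c`. The value of `c` at `P`
contributes zero by the product formula, leaving only the weights. Finite support is needed to split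
the `finsum`, which is zero by convention on infinite supports. -/
lemma HasWeight.height_eq {L : AdelicLineBundle π} {g : ∀ v : Place K, An π v → ℝ}
    (hL : L.HasWeight g) (P : AlgPoint π)
    (hg : (Function.support fun w : HeightOneSpectrum (𝓞 P.DefField) =>
      g _ (P.finitePoint w)).Finite) :
    L.height P = (Module.finrank ℚ P.DefField : ℝ)⁻¹ *
      (∑ᶠ w : HeightOneSpectrum (𝓞 P.DefField),
          (HeightOne.resDegree w : ℝ) * HeightOne.ramIdx K w * g _ (P.finitePoint w) +
        ∑ τ : P.DefField →+* ℂ, g _ (P.complexPoint τ)) := by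
  have key : ∀ (U : X.Opens) (hU : P.pt ∈ U) (r : Γ(L.sheaf, U)), IsGenerator L.sheaf U r →
      L.degreeWith P U hU r = (Module.finrank ℚ P.DefField : ℝ)⁻¹ *
      (∑ᶠ w : HeightOneSpectrum (𝓞 P.DefField),
          (HeightOne.resDegree w : ℝ) * HeightOne.ramIdx K w * g _ (P.finitePoint w) +
        ∑ τ : P.DefField →+* ℂ, g _ (P.complexPoint τ)) := by
    intro U hU r hr
    obtain ⟨c, hc, hnorm⟩ := hL.exists_unit hr
    obtain ⟨b, hb⟩ : ∃ b : P.DefField, b = X.evaluation U P.pt hU c := ⟨_, rfl⟩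
    have hb0 : b ≠ 0 := by
      rw [hb]
      exact (hc.map (X.evaluation U P.pt hU).hom).ne_zero
    have h1 : ∀ w : HeightOneSpectrum (𝓞 P.DefField),
        L.norm _ U r (P.finitePoint w) hU =
          HeightOne.extAbs K w b * Real.exp (-g _ (P.finitePoint w)) := by
      intro w
      rw [hb]
      exact hnorm _ (P.finitePoint w) hU
    have h2 : ∀ τ : P.DefField →+* ℂ, L.norm _ U r (P.complexPoint τ) hU =
        ‖τ b‖ * Real.exp (-g _ (P.complexPoint τ)) := by
      intro τ
      rw [hb]
      exact hnorm _ (P.complexPoint τ) hU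
    have h3 : ∀ w : HeightOneSpectrum (𝓞 P.DefField), (HeightOne.resDegree w : ℝ) *
        Real.log (L.norm _ U r (P.finitePoint w) hU ^ HeightOne.ramIdx K w) =
        (HeightOne.resDegree w : ℝ) *
          Real.log (HeightOne.extAbs K w b ^ HeightOne.ramIdx K w) -
        (HeightOne.resDegree w : ℝ) * HeightOne.ramIdx K w * g _ (P.finitePoint w) := by
      intro w
      rw [h1, mul_pow, Real.log_mul (pow_ne_zero _ ((map_ne_zero _).2 hb0))
        (pow_ne_zero _ (Real.exp_ne_zero _)), Real.log_pow (Real.exp _), Real.log_exp]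
      ring
    have h4 : ∀ τ : P.DefField →+* ℂ, Real.log (L.norm _ U r (P.complexPoint τ) hU) =
        Real.log ‖τ b‖ - g _ (P.complexPoint τ) := by
      intro τ
      rw [h2, Real.log_mul (by simpa using hb0) (Real.exp_ne_zero _), Real.log_exp]
      ring
    have h5 : (Function.support fun w : HeightOneSpectrum (𝓞 P.DefField) =>
        (HeightOne.resDegree w : ℝ) * HeightOne.ramIdx K w * g _ (P.finitePoint w)).Finite :=
      hg.subset fun w hw h => hw ((congrArg _ h).trans (mul_zero _))
    rw [degreeWith, finsum_congr h3, Finset.sum_congr rfl fun τ _ => h4 τ,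
      finsum_sub_distrib (HeightOne.finite_support_log_extAbs K hb0) h5, Finset.sum_sub_distrib]
    have h6 := HeightOne.sum_log_extAbs_add_sum_log K hb0
    linear_combination -(Module.finrank ℚ P.DefField : ℝ)⁻¹ * h6
  exact key _ _ _ (L.invertible P.pt).choose_spec.choose_spec.2

lemma twistFun_infinite_finite (σ : K →+* ℂ) (f : C(An π (.infinite σ), ℝ))
    (p : HeightOneSpectrum (𝓞 K)) (y : An π (.finite p)) :
    twistFun (.infinite σ) f (.finite p) y = 0 := by
  rw [twistFun, dif_neg (by simp), dif_neg (by simp [Place.conj])]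

lemma twistFun_finite_infinite (p : HeightOneSpectrum (𝓞 K)) (f : C(An π (.finite p), ℝ))
    (σ : K →+* ℂ) (y : An π (.infinite σ)) :
    twistFun (.finite p) f (.infinite σ) y = 0 := by
  rw [twistFun, dif_neg (by simp), dif_neg (by simp [Place.conj])]

lemma finrank_inv_mul (P : AlgPoint π) :
    (Module.finrank ℚ P.DefField : ℝ)⁻¹ =
      (Module.finrank ℚ K : ℝ)⁻¹ * (Module.finrank K P.DefField : ℝ)⁻¹ := by
  rw [← Module.finrank_mul_finrank ℚ K P.DefField, Nat.cast_mul, mul_inv]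

/-- Only the places above `p` contribute. There `n_w = n_𝔭 f(w|𝔭)`, and the remaining factor `e(w|𝔭)
f(w|𝔭)` is the mass that the measure gives to `w`, up to `1 / [K(P) : K]`. -/
lemma HasWeight.height_finite {L : AdelicLineBundle π} {p : HeightOneSpectrum (𝓞 K)}
    {f : C(An π (.finite p), ℝ)} (hL : L.HasWeight (twistFun (.finite p) f)) (P : AlgPoint π) :
    L.height P = (Module.finrank ℚ K : ℝ)⁻¹ *
      (HeightOne.resDegree p * Real.log (Ideal.absNorm p.asIdeal)) *
        ∫ y, f y ∂(P.measure (.finite p)) := by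
  have := Fintype.ofFinite {w : HeightOneSpectrum (𝓞 P.DefField) // w.under (𝓞 K) = p}
  let : Fintype {w : HeightOneSpectrum (𝓞 P.DefField) | w.under (𝓞 K) = p} := this
  have h0 : ∀ w : HeightOneSpectrum (𝓞 P.DefField), w.under (𝓞 K) ≠ p →
      twistFun (.finite p) f _ (P.finitePoint w) = 0 := by
    intro w hw
    rw [twistFun, dif_neg fun h => hw (Place.finite.inj h),
      dif_neg fun h : (Place.finite (w.under (𝓞 K))).conj = _ => hw (Place.finite.inj h)]
  have hfin : {w : HeightOneSpectrum (𝓞 P.DefField) | w.under (𝓞 K) = p}.Finite :=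
    Set.finite_coe_iff.1
      (inferInstanceAs (Finite {w : HeightOneSpectrum (𝓞 P.DefField) // w.under (𝓞 K) = p}))
  rw [hL.height_eq P (hfin.subset fun w hw => by_contra fun h => hw (h0 w h)),
    P.integral_measure_finite p f, finrank_inv_mul]
  simp only [twistFun_finite_infinite, Finset.sum_const_zero, add_zero]
  rw [← finsum_mem_univ, finsum_mem_inter_support_eq' _ _ {w | w.under (𝓞 K) = p} (by
    intro w hw
    refine ⟨fun _ => by_contra fun h => hw ?_, fun _ => trivial⟩
    exact (congrArg _ (h0 w h)).trans (mul_zero _)), ← finsum_set_coe_eq_finsum_mem,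
    finsum_eq_sum_of_fintype]
  have h1 : ∀ w : {w : HeightOneSpectrum (𝓞 P.DefField) // w.under (𝓞 K) = p},
      (HeightOne.resDegree w.1 : ℝ) * HeightOne.ramIdx K w.1 *
        twistFun (.finite p) f _ (P.finitePoint w.1) =
      (HeightOne.resDegree p * Real.log (Ideal.absNorm p.asIdeal)) *
        ((HeightOne.ramIdx K w.1 * HeightOne.resIdx K w.1 : ℝ) *
          f ((P.finitePoint w.1).cast (congrArg Place.finite w.2))) := by
    rintro ⟨w, rfl⟩
    rw [twistFun, dif_pos rfl, HeightOne.resDegree_eq K w, Place.logBase]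
    push_cast
    ring
  refine Eq.trans (congrArg _ (Finset.sum_congr rfl fun w _ => h1 w)) ?_
  rw [← Finset.mul_sum]
  exact mul_mul_mul_comm _ _ _ _

-- If `σ` is not real, the weight lives at `σ` and at its conjugate, and conjugation of embeddings
-- identifies the two sums; hence the factor `2`. If `σ` is real, the two places coincide and count
-- once.
open Classical in
lemma HasWeight.height_infinite {L : AdelicLineBundle π} {σ : K →+* ℂ}
    {f : C(An π (.infinite σ), ℝ)} (hL : L.HasWeight (twistFun (.infinite σ) f))
    (P : AlgPoint π) :
    L.height P = (Module.finrank ℚ K : ℝ)⁻¹ *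
      (if (starRingEnd ℂ).comp σ = σ then 1 else 2) *
        ∫ y, f y ∂(P.measure (.infinite σ)) := by
  let S := {τ : P.DefField →+* ℂ // τ.comp (algebraMap K P.DefField) = σ}
  let F : (P.DefField →+* ℂ) → ℝ := fun τ => if h : τ.comp (algebraMap K P.DefField) = σ then
    f ((P.complexPoint τ).cast (congrArg Place.infinite h)) else 0
  have hF : ∑ τ, F τ = ∑ τ : S, f ((P.complexPoint τ.1).cast (congrArg Place.infinite τ.2)) := by
    have h1 : ∀ τ : S, F τ.1 = f ((P.complexPoint τ.1).cast (congrArg Place.infinite τ.2)) :=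
      fun τ => dif_pos τ.2
    rw [← Finset.sum_congr rfl fun τ _ => h1 τ, ← Finset.sum_filter_of_ne (f := F)
        (p := fun τ : P.DefField →+* ℂ => τ.comp (algebraMap K P.DefField) = σ)
        fun τ _ hτ => by_contra fun h => hτ (dif_neg h)]
    exact Finset.sum_subtype _ (by simp) F
  have hconj : ∑ τ, F ((starRingEnd ℂ).comp τ) = ∑ τ, F τ :=
    Fintype.sum_equiv (AlgPoint.conjEquiv P.DefField) _ _ fun _ => rfl
  have hT : ∀ τ, twistFun (.infinite σ) f _ (P.complexPoint τ) =
      F τ + if (starRingEnd ℂ).comp σ = σ then 0 else F ((starRingEnd ℂ).comp τ) := by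
    intro τ
    have hc : ((starRingEnd ℂ).comp τ).comp (algebraMap K P.DefField) =
        (starRingEnd ℂ).comp (τ.comp (algebraMap K P.DefField)) := RingHom.comp_assoc _ _ _
    have hinv : ∀ ρ : K →+* ℂ, (starRingEnd ℂ).comp ((starRingEnd ℂ).comp ρ) = ρ := fun ρ =>
      RingHom.ext fun a => Complex.conj_conj _
    by_cases h1 : τ.comp (algebraMap K P.DefField) = σ
    · have h2 : twistFun (.infinite σ) f _ (P.complexPoint τ) = F τ := by
        have h3 : F τ = f ((P.complexPoint τ).cast (congrArg Place.infinite h1)) := dif_pos h1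
        rw [twistFun, dif_pos (congrArg Place.infinite h1), h3]
        exact one_mul _
      rw [h2]
      by_cases hσ : (starRingEnd ℂ).comp σ = σ
      · rw [if_pos hσ, add_zero]
      · have h3 : F ((starRingEnd ℂ).comp τ) = 0 := dif_neg (by rwa [hc, h1])
        rw [if_neg hσ, h3, add_zero]
    · have h2 : F τ = 0 := dif_neg h1
      rw [h2, zero_add, twistFun, dif_neg fun h => h1 (Place.infinite.inj h)]
      by_cases h3 : (starRingEnd ℂ).comp (τ.comp (algebraMap K P.DefField)) = σ
      · have h4 : ¬ (starRingEnd ℂ).comp σ = σ := fun hσ => h1 (by rw [← hσ, ← h3, hinv])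
        have h5 : F ((starRingEnd ℂ).comp τ) = _ := dif_pos (hc.trans h3)
        have h6 : (Place.infinite (τ.comp (algebraMap K P.DefField))).conj = .infinite σ :=
          congrArg Place.infinite h3
        rw [if_neg h4, dif_pos h6, h5, P.complexPoint_conj τ h6 (hc.trans h3)]
        exact one_mul _
      · have h4 : F ((starRingEnd ℂ).comp τ) = 0 := dif_neg (by rwa [hc])
        rw [h4, ite_self, dif_neg fun h : (Place.infinite _).conj = _ =>
          h3 (Place.infinite.inj h)]
  rw [hL.height_eq P (by simp only [twistFun_infinite_finite]; simp),
    P.integral_measure_infinite σ f, finrank_inv_mul]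
  simp only [twistFun_infinite_finite, mul_zero, finsum_zero, zero_add, hT,
    Finset.sum_add_distrib, hF]
  split_ifs with hσ
  · rw [Finset.sum_const_zero]
    ring
  · rw [hconj, hF]
    ring

-- Only two features of `C` matter later: it is independent of `L`, `f` and `P`, and it is positive,
-- so that it can be divided out.
open Classical in
lemma exists_height_eq (v : Place K) : ∃ C : ℝ, 0 < C ∧
    ∀ (L : AdelicLineBundle π) (f : C(An π v, ℝ)), L.HasWeight (twistFun v f) →
      ∀ P : AlgPoint π, L.height P = C * ∫ y, f y ∂(P.measure v) := by
  have hK : (0 : ℝ) < (Module.finrank ℚ K : ℝ)⁻¹ := by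
    have := Module.finrank_pos (R := ℚ) (M := K)
    positivity
  cases v with
  | finite p =>
    refine ⟨_, mul_pos hK (mul_pos (Nat.cast_pos.2 (HeightOne.resDegree_pos K p))
      (Real.log_pos ?_)), fun L f hL P => hL.height_finite P⟩
    exact_mod_cast HeightOneSpectrum.one_lt_absNorm p
  | infinite σ =>
    exact ⟨_, mul_pos hK (by split_ifs <;> norm_num), fun L f hL P => hL.height_infinite P⟩

end AdelicLineBundle

end Height


/-! ### Morphisms from spectra of local rings to a scheme -/

/-! ### Convergence of measures and of heights -/

section Convergence

lemma integrable_continuousMap {Y : Type*} [TopologicalSpace Y] [CompactSpace Y]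
    [MeasurableSpace Y] [BorelSpace Y] (μ : Measure Y) [IsFiniteMeasure μ] (f : C(Y, ℝ)) :
    Integrable f μ :=
  .of_bound f.continuous.stronglyMeasurable.aestronglyMeasurable ‖f‖
    (Eventually.of_forall f.norm_coe_le_norm)

lemma integral_continuousMap_add {Y : Type*} [TopologicalSpace Y] [CompactSpace Y]
    [MeasurableSpace Y] [BorelSpace Y] (μ : Measure Y) [IsFiniteMeasure μ] (f g : C(Y, ℝ)) :
    ∫ y, (f + g) y ∂μ = ∫ y, f y ∂μ + ∫ y, g y ∂μ :=
  integral_add (integrable_continuousMap μ f) (integrable_continuousMap μ g)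

/-- If the integrals of all the continuous functions on a compact space converge, the measures
converge. -/
lemma exists_limit_measure {Y : Type*} [TopologicalSpace Y] [CompactSpace Y] [T2Space Y]
    [MeasurableSpace Y] [BorelSpace Y] (η : ℕ → Measure Y) [∀ n, IsProbabilityMeasure (η n)]
    (h : ∀ f : C(Y, ℝ), ∃ r : ℝ, Tendsto (fun n => ∫ y, f y ∂(η n)) atTop (nhds r)) :
    ∃ μ : Measure Y, IsProbabilityMeasure μ ∧ ∀ f : C(Y, ℝ),
      Tendsto (fun n => ∫ y, f y ∂(η n)) atTop (nhds (∫ y, f y ∂μ)) := by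
  choose Λ hΛ using h
  let Λ' : CompactlySupportedContinuousMap Y ℝ →ₗ[ℝ] ℝ :=
    { toFun := fun f => Λ f.toContinuousMap
      map_add' := fun f g => tendsto_nhds_unique (hΛ _)
        (((hΛ f.toContinuousMap).add (hΛ g.toContinuousMap)).congr fun n =>
          (integral_continuousMap_add (η n) f.toContinuousMap g.toContinuousMap).symm)
      map_smul' := fun c f => tendsto_nhds_unique (hΛ _)
        (((hΛ f.toContinuousMap).const_mul c).congr fun n => (integral_const_mul c _).symm) }
  let Λ'' : CompactlySupportedContinuousMap Y ℝ →ₚ[ℝ] ℝ := PositiveLinearMap.mk₀ Λ' fun f hf =>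
    ge_of_tendsto (hΛ f.toContinuousMap) (Eventually.of_forall fun n => integral_nonneg hf)
  have key : ∀ f : C(Y, ℝ), ∫ y, f y ∂(RealRMK.rieszMeasure Λ'') = Λ f := fun f =>
    RealRMK.integral_rieszMeasure Λ'' (CompactlySupportedContinuousMap.continuousMapEquiv f)
  refine ⟨RealRMK.rieszMeasure Λ'', ⟨?_⟩, fun f => by rw [key]; exact hΛ f⟩
  have h1 : Λ 1 = 1 := tendsto_nhds_unique (hΛ 1) (tendsto_const_nhds.congr fun n => by simp)
  have h2 := key 1
  rw [h1] at h2
  simp only [ContinuousMap.one_apply, integral_const, smul_eq_mul, mul_one, Measure.real] at h2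
  -- Since `toReal` sends `∞` to `0`, the value `1` also excludes infinite mass.
  exact (ENNReal.toReal_eq_one_iff _).1 h2

/-- As `liminf (-u) = -limsup u`, the hypothesis reads `liminf u - limsup u = 0`. -/
lemma exists_tendsto_of_liminf_add_liminf_neg {u : ℕ → ℝ}
    (h : liminf (fun n => (u n : EReal)) atTop + liminf (fun n => ((-u n : ℝ) : EReal)) atTop = 0) :
    ∃ r : ℝ, Tendsto u atTop (nhds r) := by
  have h1 : liminf (fun n => ((-u n : ℝ) : EReal)) atTop =
      -limsup (fun n => (u n : EReal)) atTop := by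
    rw [← EReal.liminf_neg]
    rfl
  rw [h1] at h
  generalize hA : liminf (fun n => (u n : EReal)) atTop = A at h
  generalize hB : limsup (fun n => (u n : EReal)) atTop = B at h
  -- A sum in `EReal` with an infinite term is infinite, as `⊤ + ⊥ = ⊥`; so a sum equal to `0`
  -- forces both terms to be real.
  have h2 : ∃ r : ℝ, A = r ∧ B = r := by
    induction A with
    | bot => simp at h
    | top => induction B <;> simp at h
    | coe a =>
      induction B with
      | bot => simp at h
      | top => simp at h
      | coe b =>
        refine ⟨a, rfl, ?_⟩
        have h3 : a + -b = 0 := by exact_mod_cast h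
        rw [eq_neg_of_add_eq_zero_left h3, neg_neg]
  obtain ⟨r, rfl, rfl⟩ := h2
  exact ⟨r, EReal.tendsto_coe.1 (tendsto_of_liminf_eq_limsup hA hB)⟩

/-! ### Tensor products of twists and the two implications -/

variable {K : Type u} [Field K] [NumberField K] {X : Scheme.{u}} {π : X ⟶ Spec (.of K)}

lemma An.conj_cast {v w : Place K} (h : w = v) (z : An π w) (hv : v.conj = v) :
    (z.cast h).conj.cast hv = z.conj.cast ((congrArg Place.conj h).trans hv) := by
  subst h
  rfl

lemma twistFun_add (v : Place K) (f g : C(An π v, ℝ)) :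
    twistFun v (f + g) = fun w y => twistFun v f w y + twistFun v g w y := by
  funext w y
  unfold twistFun
  split_ifs <;> simp [mul_add]

lemma IsConjInvariant.add {v : Place K} {f g : C(An π v, ℝ)} (hf : IsConjInvariant f)
    (hg : IsConjInvariant g) : IsConjInvariant (f + g) := fun h y => by
  rw [ContinuousMap.add_apply, ContinuousMap.add_apply, hf h y, hg h y]

/-- Multiplication of functions as a pairing of `𝒪_X`-modules. -/
def mulPairing (U : X.Opens) : Γ(structureModule X, U) →ₗ[Γ(X, U)]
    Γ(structureModule X, U) →ₗ[Γ(X, U)] Γ(structureModule X, U) :=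
  LinearMap.mk₂ Γ(X, U) (fun s t => (toFun s * toFun t : Γ(X, U)))
    (fun s s' t => add_mul (toFun s) (toFun s') (toFun t))
    (fun a s t => mul_assoc a (toFun s) (toFun t))
    (fun s t t' => mul_add (toFun s) (toFun t) (toFun t'))
    (fun a s t => mul_left_comm (toFun s) a (toFun t))

lemma isGenerator_structureModule_iff {U : X.Opens} (s : Γ(structureModule X, U)) :
    IsGenerator (structureModule X) U s ↔ IsUnit (toFun s) := by
  constructor
  · intro h
    obtain ⟨a, ha⟩ := (h U (𝟙 U)).2 (unitSection X U)
    have h2 : a * X.presheaf.map (𝟙 U).op (toFun s) = 1 := ha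
    rw [op_id, X.presheaf.map_id] at h2
    exact IsUnit.of_mul_eq_one_right _ h2
  · intro h V i
    have h1 : IsUnit (X.presheaf.map i.op (toFun s)) := h.map (X.presheaf.map i.op).hom
    exact IsUnit.isUnit_iff_mulRight_bijective.1 h1

lemma isTensorProduct_twist (v : Place K) {f g : C(An π v, ℝ)} (hf : IsConjInvariant f)
    (hg : IsConjInvariant g) (hfg : IsConjInvariant (f + g)) :
    (twist v f hf).IsTensorProduct (twist v g hg) (twist v (f + g) hfg) := by
  refine ⟨mulPairing, fun U V i s t => map_mul (X.presheaf.map i.op).hom (toFun s) (toFun t),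
    fun U s t hs ht => ?_, fun w U s t y h => ?_⟩
  · exact (isGenerator_structureModule_iff _).2
      (((isGenerator_structureModule_iff s).1 hs).mul ((isGenerator_structureModule_iff t).1 ht))
  · change y.absEval U h (toFun s * toFun t) * Real.exp (-twistFun v (f + g) w y) =
      (y.absEval U h (toFun s) * Real.exp (-twistFun v f w y)) *
        (y.absEval U h (toFun t) * Real.exp (-twistFun v g w y))
    rw [twistFun_add, neg_add, Real.exp_add, An.absEval, map_mul, map_mul, An.absEval, An.absEval]
    ring

lemma twist_mem_metricTwists (v : Place K) (f : C(An π v, ℝ)) (hf : IsConjInvariant f) :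
    twist v f hf ∈ metricTwists π v :=
  ⟨f, hf, Iso.refl _, fun _ _ _ _ _ => rfl⟩

variable [IsProper π]

/-- Members of `metricTwists`, and any tensor product of two of them, have weights `twistFun v k`;
their heights therefore converge to `C * ∫ k dμ`, which is additive in `k`. -/
lemma Equidistributed.isAdditiveOnTwists {v : Place K} {x : ℕ → AlgPoint π}
    (h : Equidistributed v x) : IsAdditiveOnTwists v (liminfHeight x) := by
  obtain ⟨μ, hμ, h⟩ := h
  obtain ⟨C, hC, hheight⟩ := AdelicLineBundle.exists_height_eq (π := π) v
  rintro L ⟨f, hf, hL⟩ M ⟨g, hg, hM⟩ P hP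
  have hL' := (AdelicLineBundle.hasWeight_twist v f hf).of_isometric hL
  have hM' := (AdelicLineBundle.hasWeight_twist v g hg).of_isometric hM
  have hP' := hL'.tensor hM' hP
  rw [← twistFun_add] at hP'
  have key : ∀ (N : AdelicLineBundle π) (k : C(An π v, ℝ)), N.HasWeight (twistFun v k) →
      liminfHeight x N = ((C * ∫ y, k y ∂μ : ℝ) : EReal) := by
    intro N k hN
    refine Tendsto.liminf_eq (EReal.tendsto_coe.2 ?_)
    exact ((h k).const_mul C).congr fun n => (hheight N k hN (x n)).symm
  rw [key L f hL', key M g hM', key P _ hP', integral_continuousMap_add, mul_add, EReal.coe_add]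

/-- Additivity is used only for the pair `𝒪_v(f)`, `𝒪_v(-f)`, whose tensor product has height zero
at every point. -/
lemma IsAdditiveOnTwists.exists_tendsto {v : Place K} {x : ℕ → AlgPoint π}
    (h : IsAdditiveOnTwists v (liminfHeight x)) {f : C(An π v, ℝ)} (hf : IsConjInvariant f) :
    ∃ r : ℝ, Tendsto (fun n => ∫ y, f y ∂((x n).measure v)) atTop (nhds r) := by
  obtain ⟨C, hC, hheight⟩ := AdelicLineBundle.exists_height_eq (π := π) v
  have hf' : IsConjInvariant (-f) := fun h y => congrArg Neg.neg (hf h y)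
  have h0 : IsConjInvariant (f + -f) := hf.add hf'
  have h1 := h _ (twist_mem_metricTwists v f hf) _ (twist_mem_metricTwists v (-f) hf') _
    (isTensorProduct_twist v hf hf' h0)
  have h2 : ∀ (k : C(An π v, ℝ)) (hk : IsConjInvariant k), liminfHeight x (twist v k hk) =
      liminf (fun n => ((C * ∫ y, k y ∂((x n).measure v) : ℝ) : EReal)) atTop := by
    intro k hk
    unfold liminfHeight
    congr 1
    funext n
    rw [hheight _ k (AdelicLineBundle.hasWeight_twist v k hk)]
  have h3 : ∀ n, C * ∫ y, (f + -f) y ∂((x n).measure v) = 0 := by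
    intro n
    simp
  have h4 : ∀ n, C * ∫ y, (-f) y ∂((x n).measure v) = -(C * ∫ y, f y ∂((x n).measure v)) := by
    intro n
    rw [← mul_neg, ← integral_neg]
    rfl
  rw [h2, h2, h2] at h1
  simp only [h3, h4, EReal.coe_zero, liminf_const] at h1
  obtain ⟨r, hr⟩ := exists_tendsto_of_liminf_add_liminf_neg h1.symm
  refine ⟨C⁻¹ * r, (hr.const_mul C⁻¹).congr fun n => ?_⟩
  rw [inv_mul_cancel_left₀ hC.ne']

lemma IsAdditiveOnTwists.equidistributed {v : Place K} {x : ℕ → AlgPoint π}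
    (h : IsAdditiveOnTwists v (liminfHeight x)) : Equidistributed v x := by
  refine exists_limit_measure (fun n => (x n).measure v) fun f => ?_
  by_cases hv : v.conj = v
  -- `f + c` is invariant and has twice the integral of `f`. Finite places are included here; for
  -- them `c` is `f`.
  · let c : C(An π v, ℝ) := f.comp ⟨_, An.continuous_conj_cast hv⟩
    have hinv : IsConjInvariant (f + c) := by
      intro h' y
      have h1 : (y.conj.cast h').conj.cast h' = y :=
        (An.conj_cast h' y.conj h').trans (An.conj_conj_cast y _)
      change f (y.conj.cast h') + f ((y.conj.cast h').conj.cast hv) = f y + f (y.conj.cast hv)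
      rw [h1, add_comm]
    obtain ⟨r, hr⟩ := h.exists_tendsto hinv
    refine ⟨2⁻¹ * r, (hr.const_mul 2⁻¹).congr fun n => ?_⟩
    have h1 : ∫ y, c y ∂((x n).measure v) = ∫ y, f y ∂((x n).measure v) :=
      (x n).integral_measure_conj hv f
    rw [integral_continuousMap_add, h1]
    ring
  -- At a non-real embedding the invariance condition is vacuous.
  · exact h.exists_tendsto fun h' => absurd h' hv

end Convergence

theorem mainTheorem7 {K : Type u} [Field K] [NumberField K] {X : Scheme.{u}}
    (π : X ⟶ Spec (.of K)) [IsIntegral X] [IsProper π] (v : Place K) (x : ℕ → AlgPoint π) :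
    Equidistributed v x ↔ IsAdditiveOnTwists v (liminfHeight x) :=
  ⟨Equidistributed.isAdditiveOnTwists, IsAdditiveOnTwists.equidistributed⟩

end
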